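/- **Setting.** Manifolds are smooth, finite dimensional, Hausdorff and second countable. A *Lie groupoid* $\mathbb X=[X_1\rightrightarrows X_0]$ has manifolds of objects and of morphisms, smooth structure maps, and submersions as source and target. A *Lie 2-group* $\mathbb G=[G_1\rightrightarrows G_0]$ is a Lie groupoid such that $G_0,G_1$ are Lie groups and all the structure maps (including the composition) are group homomorphisms. Differentiating the structure maps at the identities gives the Lie groupoid $L(\mathbb G)=[L(G_1)\rightrightarrows L(G_0)]$; write $s,t$ for its source and target. For a Lie groupoid $\mathbb E$ let $T\mathbb E=[TE_1\rightrightarrows TE_0]$ be the tangent groupoid. A *principal $\mathbb G$-bundle* $\pi\colon\mathbb E\to\mathbb X$ is a smooth functor together with a right action of $\mathbb G$ on $\mathbb E$ by a smooth functor $\mathbb E\times\mathbb G\to\mathbb E$, such that $E_i\to X_i$ is a principal $G_i$-bundle for $i=0,1$. Fix one. **Gauge 2-group.** The objects of $\mathcal G(\mathbb E)$ are the smooth $\mathbb G$-equivariant functors $F\colon\mathbb E\to\mathbb E$ with $\pi\circ F=\pi$ that have an inverse of the same kind. A morphism $\Psi\colon F\Rightarrow F'$ is a smooth natural transformation $\Psi\colon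 E_0\to E_1$ with $\Psi(pg)=\Psi(p)1_g$ and $\pi(\Psi(p))=1_{\pi(p)}$. With vertical composition as composition of arrows, and with the composition of functors and the horizontal composition $\circ_H$ of natural transformations as group multiplications, $\mathcal G(\mathbb E)$ is a strict 2-group. Let $F^{-1}$ and $\Psi^{-1}\colon F^{-1}\Rightarrow F'^{-1}$ be the inverses for these multiplications, and $F_*,\Psi_*$ the differentials of $F,\Psi$. **Connection 1-forms.** $\mathbb G$ acts on $T\mathbb E$ by differentials and on $L(\mathbb G)$ by $A\cdot g=\mathrm{Ad}_{g^{-1}}A$. Let $\Omega_{\mathbb E^{\mathbb G}}$ be the following category. An object is a $\mathbb G$-equivariant smooth functor $\omega\colon T\mathbb E\to L(\mathbb G)$ that is a differential 1-form (fibrewise linear) on $E_0$ and on $E_1$. A morphism $\zeta\colon\omega\Rightarrow\omega'$ is a natural transformation $\zeta\colon TE_0\to L(G_1)$ that is a smooth differential 1-form on $E_0$ and satisfies $\zeta\bigl((p,v)\cdot g\bigr)=\zeta(p,v)\cdot 1_g$. Let $\delta\colon\mathbb E\times L(\mathbb G)\to T\mathbb E$ be the functor given by the fundamental vector fields, $\delta(x,A)=\frac{d}{dt}\big|_{t=0}x\exp(tA)$.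 An object $\omega$ is a *strict connection 1-form* if $\omega\circ\delta=\mathrm{pr}_2$. It is a *semi-strict connection 1-form* if there is a natural isomorphism $\kappa\colon\omega\circ\delta\Rightarrow\mathrm{pr}_2$ given by a smooth map $E_0\times L(G_0)\to L(G_1)$ that is linear in the second variable and satisfies $\kappa\bigl((p,B)\cdot g\bigr)=\kappa(p,B)\cdot 1_g$. Let $\Omega^{\rm strict}_{\mathbb E}\subset\Omega^{\rm semi}_{\mathbb E}\subset\Omega_{\mathbb E^{\mathbb G}}$ be the corresponding full subcategories. **Proposition.** The assignments $$(F,\omega)\longmapsto\omega\circ F_*^{-1},\qquad (\Psi\colon F\Rightarrow F',\ \zeta\colon\omega\Rightarrow\omega')\longmapsto \bigl(\zeta\circ_H\Psi_*^{-1}\colon\ \omega\circ F_*^{-1}\Rightarrow\omega'\circ F_*'^{-1}\bigr),$$ where $F_*^{-1}=(F^{-1})_*$, $\Psi_*^{-1}=(\Psi^{-1})_*$ and $$(\zeta\circ_H\Psi_*^{-1})(V)=\zeta\bigl(F_*'^{-1}V\bigr)\circ\omega\bigl(\Psi_*^{-1}V\bigr)\qquad(V\in TE_0)$$ (composition in $L(\mathbb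 G)$), define a strict left action of the 2-group $\mathcal G(\mathbb E)$ on the category $\Omega^{\rm semi}_{\mathbb E}$. That is, they define a functor $\mathcal G(\mathbb E)\times\Omega^{\rm semi}_{\mathbb E}\to\Omega^{\rm semi}_{\mathbb E}$ which satisfies the axioms of a group action both on objects and on arrows. The action restricts to such an action on $\Omega^{\rm strict}_{\mathbb E}$. -/

import Mathlib

open scoped Manifold ContDiff
open CategoryTheory

universe u v w

/-! ## Smooth manifolds and tangent bundles -/

/-- A smooth, Hausdorff, second countable, finite-dimensional real manifold. -/
structure Mfd where
  carrier : Type u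
  dim : ℕ
  [top : TopologicalSpace carrier]
  [charted : ChartedSpace (EuclideanSpace ℝ (Fin dim)) carrier]
  [smooth : IsManifold (𝓡 dim) ∞ carrier]
  [hausdorff : T2Space carrier]
  [secondCountable : SecondCountableTopology carrier]

instance : CoeSort Mfd.{u} (Type u) := ⟨Mfd.carrier⟩

attribute [instance] Mfd.top Mfd.charted Mfd.smooth Mfd.hausdorff Mfd.secondCountable

noncomputable section

/-- The total space of the tangent bundle of `M`; its elements are pairs `⟨p, v⟩`. -/
abbrev Mfd.Tan (M : Mfd.{u}) : Type u := TangentBundle (𝓡 M.dim) M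

/-- `f : M → N` is smooth. -/
def IsSmooth {M : Mfd.{u}} {N : Mfd.{v}} (f : M → N) : Prop :=
  ContMDiff (𝓡 M.dim) (𝓡 N.dim) ∞ f

/-- `f : M × N → P` is smooth. -/
def IsSmooth₂ {M : Mfd.{u}} {N : Mfd.{v}} {P : Mfd.{w}} (f : M → N → P) : Prop :=
  ContMDiff ((𝓡 M.dim).prod (𝓡 N.dim)) (𝓡 P.dim) ∞ (fun x : M × N => f x.1 x.2)

/-- The differential `f_* : TM → TN`. -/
def tan {M : Mfd.{u}} {N : Mfd.{v}} (f : M → N) : M.Tan → N.Tan :=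
  tangentMap (𝓡 M.dim) (𝓡 N.dim) f

/-! ## Lie groupoids -/

/-- A Lie groupoid `[Mor ⇉ Ob]`. The composite `comp γ₂ γ₁` (first `γ₁`, then `γ₂`) is meaningful
only for composable pairs, `src γ₂ = tgt γ₁`. Since the source and the target are submersions, the
composable pairs form an embedded submanifold of `Mor × Mor`, and smoothness of the composition on
that submanifold is the same as smoothness on that subset of `Mor × Mor`. -/
structure LieGroupoid where
  Ob : Mfd.{u}
  Mor : Mfd.{u}
  src : Mor → Ob
  tgt : Mor → Ob
  unit : Ob → Mor
  inv : Mor → Mor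
  comp : Mor → Mor → Mor
  submersion_src : Manifold.IsSubmersion (𝓡 Mor.dim) (𝓡 Ob.dim) ∞ src
  submersion_tgt : Manifold.IsSubmersion (𝓡 Mor.dim) (𝓡 Ob.dim) ∞ tgt
  smooth_src : IsSmooth src
  smooth_tgt : IsSmooth tgt
  smooth_unit : IsSmooth unit
  smooth_inv : IsSmooth inv
  smooth_comp : ContMDiffOn ((𝓡 Mor.dim).prod (𝓡 Mor.dim)) (𝓡 Mor.dim) ∞
    (fun x : Mor × Mor => comp x.1 x.2) {x | src x.1 = tgt x.2}
  src_unit : ∀ p, src (unit p) = p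
  tgt_unit : ∀ p, tgt (unit p) = p
  src_inv : ∀ γ, src (inv γ) = tgt γ
  tgt_inv : ∀ γ, tgt (inv γ) = src γ
  src_comp : ∀ γ₂ γ₁, src γ₂ = tgt γ₁ → src (comp γ₂ γ₁) = src γ₁
  tgt_comp : ∀ γ₂ γ₁, src γ₂ = tgt γ₁ → tgt (comp γ₂ γ₁) = tgt γ₂
  comp_unit : ∀ γ, comp γ (unit (src γ)) = γ
  unit_comp : ∀ γ, comp (unit (tgt γ)) γ = γ
  comp_assoc : ∀ γ₃ γ₂ γ₁, src γ₃ = tgt γ₂ → src γ₂ = tgt γ₁ →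
    comp (comp γ₃ γ₂) γ₁ = comp γ₃ (comp γ₂ γ₁)
  inv_comp : ∀ γ, comp (inv γ) γ = unit (src γ)
  comp_inv : ∀ γ, comp γ (inv γ) = unit (tgt γ)

/-- The set of composable pairs `(γ₂, γ₁)`. -/
def LieGroupoid.composable (𝕏 : LieGroupoid.{u}) : Set (𝕏.Mor × 𝕏.Mor) :=
  {x | 𝕏.src x.1 = 𝕏.tgt x.2}

/-- Composition in the tangent groupoid `T𝕏 = [T Mor ⇉ T Ob]`: the differential of the composition
of `𝕏`, along the submanifold of composable pairs, applied to the pair `(X₂, X₁)`. It is meaningful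
when `tan src X₂ = tan tgt X₁`, i.e. when `(X₂, X₁)` is tangent to that submanifold. The other
structure maps of `T𝕏` are `tan src`, `tan tgt`, `tan unit` and `tan inv`. -/
def LieGroupoid.tanComp (𝕏 : LieGroupoid.{u}) (X₂ X₁ : 𝕏.Mor.Tan) : 𝕏.Mor.Tan :=
  ⟨𝕏.comp X₂.proj X₁.proj,
    mfderivWithin ((𝓡 𝕏.Mor.dim).prod (𝓡 𝕏.Mor.dim)) (𝓡 𝕏.Mor.dim)
      (fun x : 𝕏.Mor × 𝕏.Mor => 𝕏.comp x.1 x.2) 𝕏.composable (X₂.proj, X₁.proj) (X₂.2, X₁.2)⟩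

/-- A morphism of Lie groupoids (a smooth functor). -/
@[ext]
structure LieFunctor (𝕏 : LieGroupoid.{u}) (𝕐 : LieGroupoid.{v}) where
  ob : 𝕏.Ob → 𝕐.Ob
  mor : 𝕏.Mor → 𝕐.Mor
  smooth_ob : IsSmooth ob
  smooth_mor : IsSmooth mor
  map_src : ∀ γ, 𝕐.src (mor γ) = ob (𝕏.src γ)
  map_tgt : ∀ γ, 𝕐.tgt (mor γ) = ob (𝕏.tgt γ)
  map_unit : ∀ p, mor (𝕏.unit p) = 𝕐.unit (ob p)
  map_comp : ∀ γ₂ γ₁, 𝕏.src γ₂ = 𝕏.tgt γ₁ → mor (𝕏.comp γ₂ γ₁) = 𝕐.comp (mor γ₂) (mor γ₁)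

namespace LieGroupoid

variable (𝕏 : LieGroupoid.{u})

theorem eq_inv_of_comp {δ γ : 𝕏.Mor} (h : 𝕏.src δ = 𝕏.tgt γ)
    (h' : 𝕏.comp δ γ = 𝕏.unit (𝕏.src γ)) : δ = 𝕏.inv γ := by
  have h1 := 𝕏.comp_assoc δ γ (𝕏.inv γ) h (𝕏.tgt_inv γ).symm
  rw [𝕏.comp_inv, h', ← h, 𝕏.comp_unit] at h1
  rw [← h1, ← 𝕏.tgt_inv, 𝕏.unit_comp]

end LieGroupoid

theorem LieFunctor.map_inv {𝕏 : LieGroupoid.{u}} {𝕐 : LieGroupoid.{v}} (F : LieFunctor 𝕏 𝕐)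
    (γ : 𝕏.Mor) : F.mor (𝕏.inv γ) = 𝕐.inv (F.mor γ) := by
  apply 𝕐.eq_inv_of_comp
  · rw [F.map_src, F.map_tgt, 𝕏.src_inv]
  · rw [← F.map_comp _ _ (𝕏.src_inv γ), 𝕏.inv_comp, F.map_unit, F.map_src]

/-! ## Lie 2-groups and their Lie 2-algebras -/

/-- A (strict) Lie 2-group: a Lie groupoid whose manifolds of objects and of morphisms are Lie
groups and all of whose structure maps are group homomorphisms. -/
structure Lie2Group extends LieGroupoid.{u} where
  [grpOb : Group Ob]
  [grpMor : Group Mor]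
  [lieOb : LieGroup (𝓡 Ob.dim) ∞ Ob]
  [lieMor : LieGroup (𝓡 Mor.dim) ∞ Mor]
  src_mul : ∀ k l, src (k * l) = src k * src l
  tgt_mul : ∀ k l, tgt (k * l) = tgt k * tgt l
  unit_mul : ∀ a b, unit (a * b) = unit a * unit b
  comp_mul : ∀ k₂ k₁ l₂ l₁, src k₂ = tgt k₁ → src l₂ = tgt l₁ →
    comp (k₂ * l₂) (k₁ * l₁) = comp k₂ k₁ * comp l₂ l₁

attribute [instance] Lie2Group.grpOb Lie2Group.grpMor Lie2Group.lieOb Lie2Group.lieMor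

/-- The Lie algebra `L(G) = T₁G` of a Lie group `G`. -/
abbrev LieAlg (G : Mfd.{u}) [Group G] : Type := GroupLieAlgebra (𝓡 G.dim) G

/-- The vector space `L(G)`, viewed as the Euclidean space on which the manifold `G` is modelled.
It serves to express smoothness of maps from or to `L(G)`. -/
def LieAlg.toModel {G : Mfd.{u}} [Group G] (A : LieAlg G) : EuclideanSpace ℝ (Fin G.dim) := A

/-- The inverse of the identification `LieAlg.toModel`. -/
def LieAlg.ofModel {G : Mfd.{u}} [Group G] (A : EuclideanSpace ℝ (Fin G.dim)) : LieAlg G := A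

/-- The differential at the identity of a homomorphism of Lie groups. -/
def lieMap {G : Mfd.{u}} {K : Mfd.{v}} [Group G] [Group K] (f : G →* K) :
    LieAlg G →L[ℝ] LieAlg K :=
  mfderiv (𝓡 G.dim) (𝓡 K.dim) f 1

/-- The adjoint action of `g ∈ G` on `L(G)`: the differential at `1` of `x ↦ g * x * g⁻¹`. -/
def lieAd {G : Mfd.{u}} [Group G] (g : G) : LieAlg G →L[ℝ] LieAlg G :=
  lieMap (MulAut.conj g).toMonoidHom

namespace Lie2Group

variable (𝔾 : Lie2Group.{u})

/-- Source map `L(G₁) → L(G₀)` of the Lie groupoid `L(𝔾)`. -/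
def lieSrc : LieAlg 𝔾.Mor →L[ℝ] LieAlg 𝔾.Ob := lieMap (MonoidHom.mk' 𝔾.src 𝔾.src_mul)

/-- Target map `L(G₁) → L(G₀)` of the Lie groupoid `L(𝔾)`. -/
def lieTgt : LieAlg 𝔾.Mor →L[ℝ] LieAlg 𝔾.Ob := lieMap (MonoidHom.mk' 𝔾.tgt 𝔾.tgt_mul)

/-- Identity-assigning map `L(G₀) → L(G₁)` of the Lie groupoid `L(𝔾)`. -/
def lieUnit : LieAlg 𝔾.Ob →L[ℝ] LieAlg 𝔾.Mor := lieMap (MonoidHom.mk' 𝔾.unit 𝔾.unit_mul)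

/-- Composition of the Lie groupoid `L(𝔾)`: the differential at `(1, 1)`, along the submanifold of
composable pairs, of the composition of `𝔾`. It is meaningful when `lieSrc A₂ = lieTgt A₁`. -/
def lieComp (A₂ A₁ : LieAlg 𝔾.Mor) : LieAlg 𝔾.Mor :=
  mfderivWithin ((𝓡 𝔾.Mor.dim).prod (𝓡 𝔾.Mor.dim)) (𝓡 𝔾.Mor.dim)
    (fun x : 𝔾.Mor × 𝔾.Mor => 𝔾.comp x.1 x.2) 𝔾.composable (1, 1) (A₂, A₁)

end Lie2Group

/-! ## Actions of Lie 2-groups and principal 2-bundles -/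

/-- A (right) action of a Lie 2-group `𝔾` on a Lie groupoid `𝔼`: a smooth functor `𝔼 × 𝔾 → 𝔼`
which is a Lie group action on objects and on morphisms. -/
structure LieAction (𝔼 : LieGroupoid.{u}) (𝔾 : Lie2Group.{w}) where
  ob : 𝔼.Ob → 𝔾.Ob → 𝔼.Ob
  mor : 𝔼.Mor → 𝔾.Mor → 𝔼.Mor
  smooth_ob : IsSmooth₂ ob
  smooth_mor : IsSmooth₂ mor
  ob_one : ∀ p, ob p 1 = p
  ob_mul : ∀ p g h, ob p (g * h) = ob (ob p g) h
  mor_one : ∀ γ, mor γ 1 = γ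
  mor_mul : ∀ γ k l, mor γ (k * l) = mor (mor γ k) l
  map_src : ∀ γ k, 𝔼.src (mor γ k) = ob (𝔼.src γ) (𝔾.src k)
  map_tgt : ∀ γ k, 𝔼.tgt (mor γ k) = ob (𝔼.tgt γ) (𝔾.tgt k)
  map_unit : ∀ p g, mor (𝔼.unit p) (𝔾.unit g) = 𝔼.unit (ob p g)
  map_comp : ∀ γ₂ γ₁ k₂ k₁, 𝔼.src γ₂ = 𝔼.tgt γ₁ → 𝔾.src k₂ = 𝔾.tgt k₁ →
    mor (𝔼.comp γ₂ γ₁) (𝔾.comp k₂ k₁) = 𝔼.comp (mor γ₂ k₂) (mor γ₁ k₁)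

theorem Lie2Group.unit_comp_unit (𝔾 : Lie2Group.{w}) (g : 𝔾.Ob) :
    𝔾.comp (𝔾.unit g) (𝔾.unit g) = 𝔾.unit g := by
  have h := 𝔾.comp_unit (𝔾.unit g)
  rwa [𝔾.src_unit] at h

theorem LieAction.act_comp_unit {𝔼 : LieGroupoid.{u}} {𝔾 : Lie2Group.{w}} (ρ : LieAction 𝔼 𝔾)
    (γ₂ γ₁ : 𝔼.Mor) (g : 𝔾.Ob) (h : 𝔼.src γ₂ = 𝔼.tgt γ₁) :
    ρ.mor (𝔼.comp γ₂ γ₁) (𝔾.unit g) =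
      𝔼.comp (ρ.mor γ₂ (𝔾.unit g)) (ρ.mor γ₁ (𝔾.unit g)) := by
  have := ρ.map_comp γ₂ γ₁ (𝔾.unit g) (𝔾.unit g) h (by rw [𝔾.src_unit, 𝔾.tgt_unit])
  rwa [𝔾.unit_comp_unit] at this

theorem LieAction.act_inv_unit {𝔼 : LieGroupoid.{u}} {𝔾 : Lie2Group.{w}} (ρ : LieAction 𝔼 𝔾)
    (γ : 𝔼.Mor) (g : 𝔾.Ob) :
    ρ.mor (𝔼.inv γ) (𝔾.unit g) = 𝔼.inv (ρ.mor γ (𝔾.unit g)) := by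
  apply 𝔼.eq_inv_of_comp
  · rw [ρ.map_src, ρ.map_tgt, 𝔼.src_inv, 𝔾.src_unit, 𝔾.tgt_unit]
  · rw [← ρ.act_comp_unit _ _ _ (𝔼.src_inv γ), 𝔼.inv_comp, ρ.map_unit, ρ.map_src, 𝔾.src_unit]

/-- `π : P → X`, with the map `act : P × G → P`, is a principal `G`-bundle: `act` preserves the
fibres of `π`, and over a neighbourhood `U` of each point of `X` there is a diffeomorphism
`U × G ≅ π⁻¹(U)` over `U` that intertwines `act` with right translation. -/
structure IsPrincipalBundle {P : Mfd.{u}} {X : Mfd.{v}} {G : Mfd.{w}} [Group G]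
    (π : P → X) (act : P → G → P) : Prop where
  smooth_proj : IsSmooth π
  proj_act : ∀ p g, π (act p g) = π p
  locally_trivial : ∀ x : X, ∃ (U : Set X) (φ : OpenPartialHomeomorph (X × G) P),
    IsOpen U ∧ x ∈ U ∧ φ.source = U ×ˢ Set.univ ∧ φ.target = π ⁻¹' U ∧
    ContMDiffOn ((𝓡 X.dim).prod (𝓡 G.dim)) (𝓡 P.dim) ∞ φ φ.source ∧
    ContMDiffOn (𝓡 P.dim) ((𝓡 X.dim).prod (𝓡 G.dim)) ∞ φ.symm φ.target ∧
    ∀ y ∈ U, ∀ g h : G, π (φ (y, g)) = y ∧ φ (y, g * h) = act (φ (y, g)) h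

/-- A principal `𝔾`-bundle over the Lie groupoid `𝕏`. -/
structure Principal2Bundle (𝔾 : Lie2Group.{w}) (𝕏 : LieGroupoid.{v}) where
  total : LieGroupoid.{u}
  proj : LieFunctor total 𝕏
  act : LieAction total 𝔾
  principal_ob : IsPrincipalBundle proj.ob act.ob
  principal_mor : IsPrincipalBundle proj.mor act.mor

/-! ## The gauge 2-group -/

section Gauge

variable {𝔾 : Lie2Group.{w}} {𝕏 : LieGroupoid.{v}}

/-- A morphism of principal `𝔾`-bundles over `𝕏` from `𝔼` to itself: a `𝔾`-equivariant smooth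
functor that commutes strictly with the projection to `𝕏`. -/
@[ext]
structure BundleEnd (𝔼 : Principal2Bundle.{u} 𝔾 𝕏) extends
    LieFunctor 𝔼.total 𝔼.total where
  equivariant_ob : ∀ p g, ob (𝔼.act.ob p g) = 𝔼.act.ob (ob p) g
  equivariant_mor : ∀ γ k, mor (𝔼.act.mor γ k) = 𝔼.act.mor (mor γ) k
  proj_ob : ∀ p, 𝔼.proj.ob (ob p) = 𝔼.proj.ob p
  proj_mor : ∀ γ, 𝔼.proj.mor (mor γ) = 𝔼.proj.mor γ

variable {𝔼 : Principal2Bundle.{u} 𝔾 𝕏}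

/-- Bundle endomorphisms form a monoid under composition of functors. -/
instance : Monoid (BundleEnd 𝔼) where
  mul F K :=
    { ob := F.ob ∘ K.ob
      mor := F.mor ∘ K.mor
      smooth_ob := F.smooth_ob.comp K.smooth_ob
      smooth_mor := F.smooth_mor.comp K.smooth_mor
      map_src := fun γ => by simp [F.map_src, K.map_src]
      map_tgt := fun γ => by simp [F.map_tgt, K.map_tgt]
      map_unit := fun p => by simp [F.map_unit, K.map_unit]
      map_comp := fun γ₂ γ₁ h => by
        simp only [Function.comp_apply]
        rw [K.map_comp _ _ h, F.map_comp _ _ (by rw [K.map_src, K.map_tgt, h])]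
      equivariant_ob := fun p g => by simp [F.equivariant_ob, K.equivariant_ob]
      equivariant_mor := fun p g => by simp [F.equivariant_mor, K.equivariant_mor]
      proj_ob := fun p => by simp [F.proj_ob, K.proj_ob]
      proj_mor := fun p => by simp [F.proj_mor, K.proj_mor] }
  one :=
    { ob := id
      mor := id
      smooth_ob := contMDiff_id
      smooth_mor := contMDiff_id
      map_src := fun _ => rfl
      map_tgt := fun _ => rfl
      map_unit := fun _ => rfl
      map_comp := fun _ _ _ => rfl
      equivariant_ob := fun _ _ => rfl
      equivariant_mor := fun _ _ => rfl
      proj_ob := fun _ => rfl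
      proj_mor := fun _ => rfl }
  mul_assoc _ _ _ := rfl
  one_mul _ := rfl
  mul_one _ := rfl

@[simp] theorem BundleEnd.mul_ob (F K : BundleEnd 𝔼) (p : 𝔼.total.Ob) :
    (F * K).ob p = F.ob (K.ob p) := rfl

@[simp] theorem BundleEnd.mul_mor (F K : BundleEnd 𝔼) (γ : 𝔼.total.Mor) :
    (F * K).mor γ = F.mor (K.mor γ) := rfl

@[simp] theorem BundleEnd.one_ob (p : 𝔼.total.Ob) : (1 : BundleEnd 𝔼).ob p = p := rfl

@[simp] theorem BundleEnd.one_mor (γ : 𝔼.total.Mor) : (1 : BundleEnd 𝔼).mor γ = γ := rfl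

variable (𝔼) in
/-- The gauge transformations of `𝔼`, i.e. its (strictly invertible) automorphisms. -/
abbrev Gauge : Type u := (BundleEnd 𝔼)ˣ

namespace Gauge

@[simp] theorem inv_ob_ob (F : Gauge 𝔼) (p : 𝔼.total.Ob) : F⁻¹.val.ob (F.val.ob p) = p := by
  rw [← BundleEnd.mul_ob, Units.inv_mul, BundleEnd.one_ob]

@[simp] theorem ob_inv_ob (F : Gauge 𝔼) (p : 𝔼.total.Ob) : F.val.ob (F⁻¹.val.ob p) = p := by
  rw [← BundleEnd.mul_ob, Units.mul_inv, BundleEnd.one_ob]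

@[simp] theorem inv_mor_mor (F : Gauge 𝔼) (γ : 𝔼.total.Mor) :
    F⁻¹.val.mor (F.val.mor γ) = γ := by
  rw [← BundleEnd.mul_mor, Units.inv_mul, BundleEnd.one_mor]

@[simp] theorem mor_inv_mor (F : Gauge 𝔼) (γ : 𝔼.total.Mor) :
    F.val.mor (F⁻¹.val.mor γ) = γ := by
  rw [← BundleEnd.mul_mor, Units.mul_inv, BundleEnd.one_mor]

/-- A 2-morphism `F ⟹ F'` of gauge transformations: a smooth `𝔾`-equivariant natural transformation
lying over the identity of `𝕏`. -/
@[ext]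
structure Hom (F F' : Gauge 𝔼) where
  app : 𝔼.total.Ob → 𝔼.total.Mor
  smooth : IsSmooth app
  src_app : ∀ p, 𝔼.total.src (app p) = F.val.ob p
  tgt_app : ∀ p, 𝔼.total.tgt (app p) = F'.val.ob p
  natural : ∀ γ, 𝔼.total.comp (app (𝔼.total.tgt γ)) (F.val.mor γ) =
    𝔼.total.comp (F'.val.mor γ) (app (𝔼.total.src γ))
  equivariant : ∀ p g, app (𝔼.act.ob p g) = 𝔼.act.mor (app p) (𝔾.unit g)
  vertical : ∀ p, 𝔼.proj.mor (app p) = 𝕏.unit (𝔼.proj.ob p)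


theorem Hom.heq {F₁ F₂ K₁ K₂ : Gauge 𝔼} (h₁ : F₁ = K₁) (h₂ : F₂ = K₂) (Φ : Hom F₁ F₂)
    (Ψ : Hom K₁ K₂) (h : Φ.app = Ψ.app) : HEq Φ Ψ := by
  subst h₁ h₂
  exact heq_of_eq (Hom.ext h)

/-- The identity natural transformation. -/
def idHom (F : Gauge 𝔼) : Hom F F where
  app p := 𝔼.total.unit (F.val.ob p)
  smooth := 𝔼.total.smooth_unit.comp F.val.smooth_ob
  src_app p := 𝔼.total.src_unit _
  tgt_app p := 𝔼.total.tgt_unit _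
  natural γ := by
    rw [← F.val.map_tgt, 𝔼.total.unit_comp, ← F.val.map_src, 𝔼.total.comp_unit]
  equivariant p g := by rw [F.val.equivariant_ob, 𝔼.act.map_unit]
  vertical p := by rw [𝔼.proj.map_unit, F.val.proj_ob]

/-- Vertical composition: `(Ψ ∘ Φ)(p) = Ψ(p) ∘ Φ(p)`. -/
def vcomp {F₁ F₂ F₃ : Gauge 𝔼} (Φ : Hom F₁ F₂) (Ψ : Hom F₂ F₃) : Hom F₁ F₃ where
  app p := 𝔼.total.comp (Ψ.app p) (Φ.app p)
  smooth := by
    have h := 𝔼.total.smooth_comp.comp_contMDiff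
      (f := fun p => (Ψ.app p, Φ.app p)) (Ψ.smooth.prodMk Φ.smooth)
      (fun p => by simp [Ψ.src_app, Φ.tgt_app])
    exact h
  src_app p := by rw [𝔼.total.src_comp _ _ (by rw [Ψ.src_app, Φ.tgt_app]), Φ.src_app]
  tgt_app p := by rw [𝔼.total.tgt_comp _ _ (by rw [Ψ.src_app, Φ.tgt_app]), Ψ.tgt_app]
  natural γ := by
    rw [𝔼.total.comp_assoc, Φ.natural, ← 𝔼.total.comp_assoc, Ψ.natural, 𝔼.total.comp_assoc]
    all_goals simp [Φ.src_app, Φ.tgt_app, Ψ.src_app, Ψ.tgt_app, F₁.val.map_tgt,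
      F₂.val.map_src, F₂.val.map_tgt, F₃.val.map_src]
  equivariant p g := by
    rw [Φ.equivariant, Ψ.equivariant, 𝔼.act.act_comp_unit _ _ _ (by rw [Ψ.src_app, Φ.tgt_app])]
  vertical p := by
    rw [𝔼.proj.map_comp _ _ (by rw [Ψ.src_app, Φ.tgt_app]), Φ.vertical, Ψ.vertical]
    have h := 𝕏.comp_unit (𝕏.unit (𝔼.proj.ob p))
    rwa [𝕏.src_unit] at h

instance : Category.{u} (Gauge 𝔼) where
  Hom := Hom
  id := idHom
  comp := vcomp
  id_comp {F K} Φ := Hom.ext <| funext fun p => by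
    change 𝔼.total.comp (Φ.app p) (𝔼.total.unit (F.val.ob p)) = Φ.app p
    rw [← Φ.src_app, 𝔼.total.comp_unit]
  comp_id {F K} Φ := Hom.ext <| funext fun p => by
    change 𝔼.total.comp (𝔼.total.unit (K.val.ob p)) (Φ.app p) = Φ.app p
    rw [← Φ.tgt_app, 𝔼.total.unit_comp]
  assoc Φ Ψ Θ := Hom.ext <| funext fun p => by
    change 𝔼.total.comp (Θ.app p) (𝔼.total.comp (Ψ.app p) (Φ.app p)) =
      𝔼.total.comp (𝔼.total.comp (Θ.app p) (Ψ.app p)) (Φ.app p)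
    rw [𝔼.total.comp_assoc]
    · rw [Θ.src_app, Ψ.tgt_app]
    · rw [Ψ.src_app, Φ.tgt_app]

theorem id_app (F : Gauge 𝔼) (p : 𝔼.total.Ob) :
    Hom.app (𝟙 F) p = 𝔼.total.unit (F.val.ob p) := rfl

theorem comp_app {F₁ F₂ F₃ : Gauge 𝔼} (Φ : F₁ ⟶ F₂) (Ψ : F₂ ⟶ F₃) (p : 𝔼.total.Ob) :
    Hom.app (Φ ≫ Ψ) p = 𝔼.total.comp (Ψ.app p) (Φ.app p) := rfl

/-- Horizontal composition `(Φ ∘_H Ψ)(p) = Φ(K'(p)) ∘ F(Ψ(p))` of `Φ : F ⟹ F'` and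
`Ψ : K ⟹ K'`. -/
def hcomp {F F' K K' : Gauge 𝔼} (Φ : Hom F F') (Ψ : Hom K K') : Hom (F * K) (F' * K') where
  app p := 𝔼.total.comp (Φ.app (K'.val.ob p)) (F.val.mor (Ψ.app p))
  smooth := by
    have h := 𝔼.total.smooth_comp.comp_contMDiff
      (f := fun p => (Φ.app (K'.val.ob p), F.val.mor (Ψ.app p)))
      ((Φ.smooth.comp K'.val.smooth_ob).prodMk (F.val.smooth_mor.comp Ψ.smooth))
      (fun p => by simp [Φ.src_app, F.val.map_tgt, Ψ.tgt_app])
    exact h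
  src_app p := by
    rw [𝔼.total.src_comp _ _ (by rw [Φ.src_app, F.val.map_tgt, Ψ.tgt_app]), F.val.map_src,
      Ψ.src_app]
    rfl
  tgt_app p := by
    rw [𝔼.total.tgt_comp _ _ (by rw [Φ.src_app, F.val.map_tgt, Ψ.tgt_app]), Φ.tgt_app]
    rfl
  natural γ := by
    simp only [Units.val_mul, BundleEnd.mul_mor]
    rw [𝔼.total.comp_assoc, ← F.val.map_comp, Ψ.natural, F.val.map_comp, ← 𝔼.total.comp_assoc,
      ← K'.val.map_tgt, Φ.natural, 𝔼.total.comp_assoc, K'.val.map_src]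
    all_goals simp [Φ.src_app, Φ.tgt_app, Ψ.src_app, Ψ.tgt_app, F.val.map_src, F.val.map_tgt,
      F'.val.map_src, K.val.map_tgt, K'.val.map_src, K'.val.map_tgt]
  equivariant p g := by
    rw [𝔼.act.act_comp_unit _ _ _ (by rw [Φ.src_app, F.val.map_tgt, Ψ.tgt_app]),
      K'.val.equivariant_ob, Φ.equivariant, Ψ.equivariant, F.val.equivariant_mor]
  vertical p := by
    rw [𝔼.proj.map_comp _ _ (by rw [Φ.src_app, F.val.map_tgt, Ψ.tgt_app]), Φ.vertical,
      F.val.proj_mor, Ψ.vertical, K'.val.proj_ob]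
    have h := 𝕏.comp_unit (𝕏.unit (𝔼.proj.ob p))
    rwa [𝕏.src_unit] at h

/-- The inverse `F⁻¹ ⟹ F'⁻¹` of `Φ : F ⟹ F'` for horizontal composition:
`Φ⁻¹(p) = F⁻¹(Φ(F'⁻¹(p)))⁻¹`. -/
def hinv {F F' : Gauge 𝔼} (Φ : Hom F F') : Hom F⁻¹ F'⁻¹ where
  app p := 𝔼.total.inv (F⁻¹.val.mor (Φ.app (F'⁻¹.val.ob p)))
  smooth := 𝔼.total.smooth_inv.comp (F⁻¹.val.smooth_mor.comp (Φ.smooth.comp F'⁻¹.val.smooth_ob))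
  src_app p := by
    rw [𝔼.total.src_inv, F⁻¹.val.map_tgt, Φ.tgt_app, ob_inv_ob]
  tgt_app p := by
    rw [𝔼.total.tgt_inv, F⁻¹.val.map_src, Φ.src_app, inv_ob_ob]
  natural γ := by
    have h := congrArg F⁻¹.val.mor (Φ.natural (F'⁻¹.val.mor γ))
    rw [F⁻¹.val.map_comp _ _ (by rw [Φ.src_app, F.val.map_tgt]),
      F⁻¹.val.map_comp _ _ (by rw [Φ.tgt_app, F'.val.map_src]), inv_mor_mor, mor_inv_mor,
      F'⁻¹.val.map_src, F'⁻¹.val.map_tgt] at h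
    set a := F⁻¹.val.mor (Φ.app (F'⁻¹.val.ob (𝔼.total.tgt γ))) with ha
    set b := F⁻¹.val.mor (Φ.app (F'⁻¹.val.ob (𝔼.total.src γ))) with hb
    have sa : 𝔼.total.src a = F'⁻¹.val.ob (𝔼.total.tgt γ) := by
      rw [ha, F⁻¹.val.map_src, Φ.src_app, inv_ob_ob]
    have ta : 𝔼.total.tgt a = F⁻¹.val.ob (𝔼.total.tgt γ) := by
      rw [ha, F⁻¹.val.map_tgt, Φ.tgt_app, ob_inv_ob]
    have sb : 𝔼.total.src b = F'⁻¹.val.ob (𝔼.total.src γ) := by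
      rw [hb, F⁻¹.val.map_src, Φ.src_app, inv_ob_ob]
    have tb : 𝔼.total.tgt b = F⁻¹.val.ob (𝔼.total.src γ) := by
      rw [hb, F⁻¹.val.map_tgt, Φ.tgt_app, ob_inv_ob]
    have h1 : F⁻¹.val.mor γ = 𝔼.total.comp (𝔼.total.comp a (F'⁻¹.val.mor γ)) (𝔼.total.inv b) := by
      rw [h, 𝔼.total.comp_assoc, 𝔼.total.comp_inv, tb, ← F⁻¹.val.map_src, 𝔼.total.comp_unit]
      · rw [F⁻¹.val.map_src, tb]
      · rw [𝔼.total.tgt_inv]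
    rw [h1, ← 𝔼.total.comp_assoc, ← 𝔼.total.comp_assoc, 𝔼.total.inv_comp, sa, ← F'⁻¹.val.map_tgt,
      𝔼.total.unit_comp]
    all_goals first
      | rw [𝔼.total.src_comp _ _ (by rw [sa, F'⁻¹.val.map_tgt])]
      | rw [𝔼.total.tgt_comp _ _ (by rw [sa, F'⁻¹.val.map_tgt])]
      | skip
    all_goals simp [sa, sb, ta, 𝔼.total.src_inv, 𝔼.total.tgt_inv, F'⁻¹.val.map_src,
      F'⁻¹.val.map_tgt]
  equivariant p g := by
    rw [F'⁻¹.val.equivariant_ob, Φ.equivariant, F⁻¹.val.equivariant_mor, 𝔼.act.act_inv_unit]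
  vertical p := by
    rw [𝔼.proj.map_inv, F⁻¹.val.proj_mor, Φ.vertical, F'⁻¹.val.proj_ob]
    symm
    apply 𝕏.eq_inv_of_comp
    · rw [𝕏.src_unit, 𝕏.tgt_unit]
    · have h := 𝕏.comp_unit (𝕏.unit (𝔼.proj.ob p))
      rw [𝕏.src_unit] at h ⊢
      exact h

end Gauge
end Gauge

/-! ## Strict 2-groups and their actions -/

/-- A strict 2-group, i.e. a group object in the category of categories: a category whose objects
form a group and whose arrows form a group, such that source, target and identities are compatible
with the group structures and the interchange law holds. -/
class Strict2Group (𝒢 : Type u) [Category.{v} 𝒢] [Group 𝒢] where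
  hmul : ∀ {a a' b b' : 𝒢}, (a ⟶ a') → (b ⟶ b') → (a * b ⟶ a' * b')
  hinv : ∀ {a a' : 𝒢}, (a ⟶ a') → (a⁻¹ ⟶ a'⁻¹)
  hmul_id : ∀ a b : 𝒢, hmul (𝟙 a) (𝟙 b) = 𝟙 (a * b)
  hmul_comp : ∀ {a a' a'' b b' b'' : 𝒢} (f : a ⟶ a') (f' : a' ⟶ a'') (g : b ⟶ b') (g' : b' ⟶ b''),
    hmul (f ≫ f') (g ≫ g') = hmul f g ≫ hmul f' g'
  hmul_assoc : ∀ {a a' b b' c c' : 𝒢} (f : a ⟶ a') (g : b ⟶ b') (h : c ⟶ c'),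
    HEq (hmul (hmul f g) h) (hmul f (hmul g h))
  one_hmul : ∀ {a a' : 𝒢} (f : a ⟶ a'), HEq (hmul (𝟙 (1 : 𝒢)) f) f
  hmul_one : ∀ {a a' : 𝒢} (f : a ⟶ a'), HEq (hmul f (𝟙 (1 : 𝒢))) f
  hinv_hmul : ∀ {a a' : 𝒢} (f : a ⟶ a'), HEq (hmul (hinv f) f) (𝟙 (1 : 𝒢))
  hmul_hinv : ∀ {a a' : 𝒢} (f : a ⟶ a'), HEq (hmul f (hinv f)) (𝟙 (1 : 𝒢))

/-- A (strict, left) action of a strict 2-group `𝒢` on a category `C`: a functor `𝒢 × C ⥤ C` which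
is a group action on objects and on arrows. -/
structure Strict2GroupAction (𝒢 : Type u) [Category.{v} 𝒢] [Group 𝒢] [Strict2Group 𝒢]
    (C : Type*) [Category C] where
  functor : 𝒢 × C ⥤ C
  one_obj : ∀ c : C, functor.obj (1, c) = c
  mul_obj : ∀ (a b : 𝒢) (c : C), functor.obj (a * b, c) = functor.obj (a, functor.obj (b, c))
  one_map : ∀ {c c' : C} (f : c ⟶ c'), HEq (functor.map (Prod.mkHom (𝟙 (1 : 𝒢)) f)) f
  mul_map : ∀ {a a' b b' : 𝒢} {c c' : C} (φ : a ⟶ a') (ψ : b ⟶ b') (f : c ⟶ c'),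
    HEq (functor.map (Prod.mkHom (Strict2Group.hmul φ ψ) f))
      (functor.map (Prod.mkHom φ (functor.map (Prod.mkHom ψ f))))

/-- The gauge 2-group of `𝔼`, with the composition of functors and the horizontal composition of
natural transformations as group structures. -/
instance {𝔾 : Lie2Group.{w}} {𝕏 : LieGroupoid.{v}} {𝔼 : Principal2Bundle.{u} 𝔾 𝕏} :
    Strict2Group (Gauge 𝔼) where
  hmul := Gauge.hcomp
  hinv := Gauge.hinv
  hmul_id F K := Gauge.Hom.ext <| funext fun p => by
    change 𝔼.total.comp (𝔼.total.unit (F.val.ob (K.val.ob p)))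
      (F.val.mor (𝔼.total.unit (K.val.ob p))) = 𝔼.total.unit (F.val.ob (K.val.ob p))
    have h := 𝔼.total.comp_unit (𝔼.total.unit (F.val.ob (K.val.ob p)))
    rw [F.val.map_unit]
    rwa [𝔼.total.src_unit] at h
  hmul_comp {F F' F'' K K' K''} Φ Φ' Ψ Ψ' := Gauge.Hom.ext <| funext fun p => by
    change 𝔼.total.comp (𝔼.total.comp (Φ'.app (K''.val.ob p)) (Φ.app (K''.val.ob p)))
        (F.val.mor (𝔼.total.comp (Ψ'.app p) (Ψ.app p))) =
      𝔼.total.comp (𝔼.total.comp (Φ'.app (K''.val.ob p)) (F'.val.mor (Ψ'.app p)))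
        (𝔼.total.comp (Φ.app (K'.val.ob p)) (F.val.mor (Ψ.app p)))
    have h := Φ.natural (Ψ'.app p)
    rw [Ψ'.tgt_app, Ψ'.src_app] at h
    rw [F.val.map_comp, 𝔼.total.comp_assoc, ← 𝔼.total.comp_assoc (Φ.app _), h,
      𝔼.total.comp_assoc, 𝔼.total.comp_assoc]
    all_goals first
      | rw [𝔼.total.tgt_comp]
      | skip
    all_goals simp [Φ.src_app, Φ.tgt_app, Φ'.src_app, Ψ.tgt_app, Ψ'.src_app,
      Ψ'.tgt_app, F.val.map_src, F.val.map_tgt, F'.val.map_src, F'.val.map_tgt]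
  hmul_assoc {F F' K K' L L'} Φ Ψ Θ := Gauge.Hom.heq (mul_assoc _ _ _) (mul_assoc _ _ _) _ _ <|
    funext fun p => by
      change 𝔼.total.comp (𝔼.total.comp (Φ.app (K'.val.ob (L'.val.ob p)))
          (F.val.mor (Ψ.app (L'.val.ob p)))) (F.val.mor (K.val.mor (Θ.app p))) =
        𝔼.total.comp (Φ.app (K'.val.ob (L'.val.ob p)))
          (F.val.mor (𝔼.total.comp (Ψ.app (L'.val.ob p)) (K.val.mor (Θ.app p))))
      rw [F.val.map_comp, 𝔼.total.comp_assoc]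
      all_goals simp [Φ.src_app, Ψ.src_app, Ψ.tgt_app, Θ.tgt_app, F.val.map_src, F.val.map_tgt,
        K.val.map_tgt]
  one_hmul {F F'} Φ := Gauge.Hom.heq (one_mul _) (one_mul _) _ _ <| funext fun p => by
    change 𝔼.total.comp (𝔼.total.unit (F'.val.ob p)) (Φ.app p) = Φ.app p
    rw [← Φ.tgt_app, 𝔼.total.unit_comp]
  hmul_one {F F'} Φ := Gauge.Hom.heq (mul_one _) (mul_one _) _ _ <| funext fun p => by
    change 𝔼.total.comp (Φ.app p) (F.val.mor (𝔼.total.unit p)) = Φ.app p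
    rw [F.val.map_unit, ← Φ.src_app, 𝔼.total.comp_unit]
  hinv_hmul {F F'} Φ := Gauge.Hom.heq (inv_mul_cancel _) (inv_mul_cancel _) _ _ <|
    funext fun p => by
      change 𝔼.total.comp (𝔼.total.inv (F⁻¹.val.mor (Φ.app (F'⁻¹.val.ob (F'.val.ob p)))))
        (F⁻¹.val.mor (Φ.app p)) = 𝔼.total.unit p
      rw [Gauge.inv_ob_ob, 𝔼.total.inv_comp, F⁻¹.val.map_src, Φ.src_app, Gauge.inv_ob_ob]
  hmul_hinv {F F'} Φ := Gauge.Hom.heq (mul_inv_cancel _) (mul_inv_cancel _) _ _ <|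
    funext fun p => by
      change 𝔼.total.comp (Φ.app (F'⁻¹.val.ob p))
        (F.val.mor (𝔼.total.inv (F⁻¹.val.mor (Φ.app (F'⁻¹.val.ob p))))) = 𝔼.total.unit p
      rw [F.val.map_inv, Gauge.mor_inv_mor, 𝔼.total.comp_inv, Φ.tgt_app, Gauge.ob_inv_ob]

/-! ## Linear algebra of the Lie 2-algebra `L(𝔾)` -/

section LieLemmas

theorem lieMap_comp {G : Mfd.{u}} {K : Mfd.{v}} {L : Mfd.{w}} [Group G] [Group K] [Group L]
    (f : G →* K) (g : K →* L) (hf : IsSmooth f) (hg : IsSmooth g) (A : LieAlg G) :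
    lieMap (g.comp f) A = lieMap g (lieMap f A) := by
  have hf' : MDifferentiableAt (𝓡 G.dim) (𝓡 K.dim) f 1 := hf.mdifferentiableAt (by simp)
  have hg' : MDifferentiableAt (𝓡 K.dim) (𝓡 L.dim) g 1 := hg.mdifferentiableAt (by simp)
  have key : ∀ x : K, x = 1 → ∀ V : EuclideanSpace ℝ (Fin K.dim), lieMap g V =
      (mfderiv (𝓡 K.dim) (𝓡 L.dim) g x V : EuclideanSpace ℝ (Fin L.dim)) := by
    rintro _ rfl V
    rfl
  have h := mfderiv_comp_of_eq (x := (1 : G)) hg' hf' (map_one f)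
  refine Eq.trans ?_ (key (f 1) (map_one f) (lieMap f A)).symm
  exact congrArg (fun D : EuclideanSpace ℝ (Fin G.dim) →L[ℝ] EuclideanSpace ℝ (Fin L.dim) => D A) h

theorem lieMap_id {G : Mfd.{u}} [Group G] (A : LieAlg G) : lieMap (MonoidHom.id G) A = A := by
  have h := mfderiv_id (I := 𝓡 G.dim) (x := (1 : G))
  exact congrArg (fun D : EuclideanSpace ℝ (Fin G.dim) →L[ℝ] EuclideanSpace ℝ (Fin G.dim) => D A) h

variable (𝔾 : Lie2Group.{u})

theorem lieComp_lieMap {G : Mfd.{v}} [Group G] (a b c : G →* 𝔾.Mor)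
    (ha : IsSmooth a) (hb : IsSmooth b) (hab : ∀ x, 𝔾.src (a x) = 𝔾.tgt (b x))
    (hc : ∀ x, 𝔾.comp (a x) (b x) = c x) (A : LieAlg G) :
    𝔾.lieComp (lieMap a A) (lieMap b A) = lieMap c A := by
  have ha' : MDifferentiableAt (𝓡 G.dim) (𝓡 𝔾.Mor.dim) a 1 := ha.mdifferentiableAt (by simp)
  have hb' : MDifferentiableAt (𝓡 G.dim) (𝓡 𝔾.Mor.dim) b 1 := hb.mdifferentiableAt (by simp)
  have hab1 : (a 1, b 1) ∈ 𝔾.composable := hab 1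
  have hm := (𝔾.smooth_comp.mdifferentiableOn (by simp) (a 1, b 1) hab1).hasMFDerivWithinAt
  have hp := (ha'.hasMFDerivAt.prodMk hb'.hasMFDerivAt).hasMFDerivWithinAt (s := Set.univ)
  have hsub : Set.univ ⊆ (fun x => (a x, b x)) ⁻¹' 𝔾.composable := fun x _ => hab x
  have h := HasMFDerivWithinAt.comp (1 : G) hm hp hsub
  rw [hasMFDerivWithinAt_univ] at h
  have h2 := h.mfderiv
  have key : ∀ x y : 𝔾.Mor, x = 1 → y = 1 → ∀ V W : EuclideanSpace ℝ (Fin 𝔾.Mor.dim),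
      𝔾.lieComp V W = (mfderivWithin ((𝓡 𝔾.Mor.dim).prod (𝓡 𝔾.Mor.dim)) (𝓡 𝔾.Mor.dim)
        (fun x : 𝔾.Mor × 𝔾.Mor => 𝔾.comp x.1 x.2) 𝔾.composable (x, y) (V, W) :
          EuclideanSpace ℝ (Fin 𝔾.Mor.dim)) := by
    rintro _ _ rfl rfl V W
    rfl
  have h3 := key (a 1) (b 1) (map_one a) (map_one b) (lieMap a A) (lieMap b A)
  have hfun : ((fun x : 𝔾.Mor × 𝔾.Mor => 𝔾.comp x.1 x.2) ∘ fun x => (a x, b x)) = c :=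
    funext hc
  rw [hfun] at h2
  refine h3.trans ?_
  exact (congrArg (fun D : EuclideanSpace ℝ (Fin G.dim) →L[ℝ]
    EuclideanSpace ℝ (Fin 𝔾.Mor.dim) => D A) h2).symm

theorem lieSrc_lieUnit (B : LieAlg 𝔾.Ob) : 𝔾.lieSrc (𝔾.lieUnit B) = B := by
  have h : (MonoidHom.mk' 𝔾.src 𝔾.src_mul).comp (MonoidHom.mk' 𝔾.unit 𝔾.unit_mul) =
    MonoidHom.id 𝔾.Ob := MonoidHom.ext 𝔾.src_unit
  exact (lieMap_comp _ _ 𝔾.smooth_unit 𝔾.smooth_src B).symm.trans (by rw [h, lieMap_id])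

theorem lieTgt_lieUnit (B : LieAlg 𝔾.Ob) : 𝔾.lieTgt (𝔾.lieUnit B) = B := by
  have h : (MonoidHom.mk' 𝔾.tgt 𝔾.tgt_mul).comp (MonoidHom.mk' 𝔾.unit 𝔾.unit_mul) =
    MonoidHom.id 𝔾.Ob := MonoidHom.ext 𝔾.tgt_unit
  exact (lieMap_comp _ _ 𝔾.smooth_unit 𝔾.smooth_tgt B).symm.trans (by rw [h, lieMap_id])

theorem lieComp_add (A B A' B' : LieAlg 𝔾.Mor) :
    𝔾.lieComp (A + A') (B + B') = 𝔾.lieComp A B + 𝔾.lieComp A' B' :=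
  map_add (mfderivWithin ((𝓡 𝔾.Mor.dim).prod (𝓡 𝔾.Mor.dim)) (𝓡 𝔾.Mor.dim)
    (fun x : 𝔾.Mor × 𝔾.Mor => 𝔾.comp x.1 x.2) 𝔾.composable (1, 1) :
      EuclideanSpace ℝ (Fin 𝔾.Mor.dim) × EuclideanSpace ℝ (Fin 𝔾.Mor.dim) →L[ℝ]
      EuclideanSpace ℝ (Fin 𝔾.Mor.dim)) (A, B) (A', B')

theorem lieComp_lieUnit (A : LieAlg 𝔾.Mor) : 𝔾.lieComp A (𝔾.lieUnit (𝔾.lieSrc A)) = A := by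
  have h := lieComp_lieMap 𝔾 (MonoidHom.id 𝔾.Mor)
    ((MonoidHom.mk' 𝔾.unit 𝔾.unit_mul).comp (MonoidHom.mk' 𝔾.src 𝔾.src_mul)) (MonoidHom.id 𝔾.Mor)
    contMDiff_id (𝔾.smooth_unit.comp 𝔾.smooth_src) (fun x => (𝔾.tgt_unit _).symm)
    (fun x => 𝔾.comp_unit x) A
  rwa [lieMap_id, lieMap_comp _ _ 𝔾.smooth_src 𝔾.smooth_unit] at h

theorem lieUnit_lieComp (A : LieAlg 𝔾.Mor) : 𝔾.lieComp (𝔾.lieUnit (𝔾.lieTgt A)) A = A := by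
  have h := lieComp_lieMap 𝔾
    ((MonoidHom.mk' 𝔾.unit 𝔾.unit_mul).comp (MonoidHom.mk' 𝔾.tgt 𝔾.tgt_mul)) (MonoidHom.id 𝔾.Mor)
    (MonoidHom.id 𝔾.Mor) (𝔾.smooth_unit.comp 𝔾.smooth_tgt) contMDiff_id (fun x => 𝔾.src_unit _)
    (fun x => 𝔾.unit_comp x) A
  rwa [lieMap_id, lieMap_comp _ _ 𝔾.smooth_tgt 𝔾.smooth_unit] at h

theorem lieUnit_lieComp_lieUnit (B : LieAlg 𝔾.Ob) :
    𝔾.lieComp (𝔾.lieUnit B) (𝔾.lieUnit B) = 𝔾.lieUnit B := by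
  have h := lieComp_lieUnit 𝔾 (𝔾.lieUnit B)
  rwa [lieSrc_lieUnit] at h

/-- Composition in the Lie 2-algebra in terms of addition. -/
theorem lieComp_eq {A₂ A₁ : LieAlg 𝔾.Mor} (h : 𝔾.lieSrc A₂ = 𝔾.lieTgt A₁) :
    𝔾.lieComp A₂ A₁ = A₂ + A₁ - 𝔾.lieUnit (𝔾.lieTgt A₁) := by
  have h1 := lieComp_add 𝔾 A₂ A₁ (𝔾.lieUnit (𝔾.lieTgt A₁)) (𝔾.lieUnit (𝔾.lieTgt A₁))
  rw [add_comm A₂, add_comm A₁, ← h] at h1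
  have h2 := lieComp_add 𝔾 (𝔾.lieUnit (𝔾.lieSrc A₂)) A₁ A₂ (𝔾.lieUnit (𝔾.lieSrc A₂))
  rw [lieComp_lieUnit, add_comm A₁, h1, lieUnit_lieComp_lieUnit] at h2
  rw [h, lieUnit_lieComp] at h2
  rw [eq_sub_iff_add_eq, h2, add_comm]

theorem isSmooth_conj {G : Mfd.{v}} [Group G] [LieGroup (𝓡 G.dim) ∞ G] (g : G) :
    IsSmooth (MulAut.conj g).toMonoidHom :=
  (contMDiff_mul_right (a := g⁻¹)).comp (contMDiff_mul_left (a := g))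

theorem lieMap_lieAd {G : Mfd.{v}} {K : Mfd.{w}} [Group G] [Group K] [LieGroup (𝓡 G.dim) ∞ G]
    [LieGroup (𝓡 K.dim) ∞ K] (f : G →* K) (hf : IsSmooth f) (g : G) (A : LieAlg G) :
    lieMap f (lieAd g A) = lieAd (f g) (lieMap f A) := by
  have h : f.comp (MulAut.conj g).toMonoidHom = (MulAut.conj (f g)).toMonoidHom.comp f := by
    ext x
    simp
  exact (lieMap_comp _ _ (isSmooth_conj g) hf A).symm.trans ((by rw [h] : _ = _).trans
    (lieMap_comp _ _ hf (isSmooth_conj (f g)) A))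

theorem lieSrc_lieAd (k : 𝔾.Mor) (A : LieAlg 𝔾.Mor) :
    𝔾.lieSrc (lieAd k A) = lieAd (𝔾.src k) (𝔾.lieSrc A) :=
  lieMap_lieAd (MonoidHom.mk' 𝔾.src 𝔾.src_mul) 𝔾.smooth_src k A

theorem lieTgt_lieAd (k : 𝔾.Mor) (A : LieAlg 𝔾.Mor) :
    𝔾.lieTgt (lieAd k A) = lieAd (𝔾.tgt k) (𝔾.lieTgt A) :=
  lieMap_lieAd (MonoidHom.mk' 𝔾.tgt 𝔾.tgt_mul) 𝔾.smooth_tgt k A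

theorem lieUnit_lieAd (g : 𝔾.Ob) (B : LieAlg 𝔾.Ob) :
    𝔾.lieUnit (lieAd g B) = lieAd (𝔾.unit g) (𝔾.lieUnit B) :=
  lieMap_lieAd (MonoidHom.mk' 𝔾.unit 𝔾.unit_mul) 𝔾.smooth_unit g B

theorem unit_inv (g : 𝔾.Ob) : 𝔾.unit g⁻¹ = (𝔾.unit g)⁻¹ :=
  map_inv (MonoidHom.mk' 𝔾.unit 𝔾.unit_mul) g

theorem lieSrc_lieComp {A₂ A₁ : LieAlg 𝔾.Mor} (h : 𝔾.lieSrc A₂ = 𝔾.lieTgt A₁) :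
    𝔾.lieSrc (𝔾.lieComp A₂ A₁) = 𝔾.lieSrc A₁ := by
  rw [lieComp_eq 𝔾 h, map_sub, map_add, lieSrc_lieUnit, h, add_sub_cancel_left]

theorem lieTgt_lieComp {A₂ A₁ : LieAlg 𝔾.Mor} (h : 𝔾.lieSrc A₂ = 𝔾.lieTgt A₁) :
    𝔾.lieTgt (𝔾.lieComp A₂ A₁) = 𝔾.lieTgt A₂ := by
  rw [lieComp_eq 𝔾 h, map_sub, map_add, lieTgt_lieUnit, add_sub_cancel_right]

theorem lieComp_assoc {A₃ A₂ A₁ : LieAlg 𝔾.Mor} (h : 𝔾.lieSrc A₃ = 𝔾.lieTgt A₂)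
    (h' : 𝔾.lieSrc A₂ = 𝔾.lieTgt A₁) :
    𝔾.lieComp (𝔾.lieComp A₃ A₂) A₁ = 𝔾.lieComp A₃ (𝔾.lieComp A₂ A₁) := by
  rw [lieComp_eq 𝔾 (by rw [lieSrc_lieComp 𝔾 h, h']),
    lieComp_eq 𝔾 (A₂ := A₃) (A₁ := 𝔾.lieComp A₂ A₁) (by rw [lieTgt_lieComp 𝔾 h', h]),
    lieTgt_lieComp 𝔾 h', lieComp_eq 𝔾 h, lieComp_eq 𝔾 h']
  abel

end LieLemmas

/-! ## Equivariant `L(𝔾)`-valued 1-forms -/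

/-- `θ : TM → L(G)` is an `L(G)`-valued (smooth) differential 1-form on `M`. -/
structure IsOneForm {M : Mfd.{u}} {G : Mfd.{w}} [Group G] (θ : M.Tan → LieAlg G) : Prop where
  smooth : ContMDiff (𝓡 M.dim).tangent (𝓡 G.dim) ∞ (fun V => (θ V).toModel)
  linear : ∀ p : M, IsLinearMap ℝ (fun v : TangentSpace (𝓡 M.dim) p => θ ⟨p, v⟩)

theorem contMDiff_toModel {G : Mfd.{v}} {K : Mfd.{w}} [Group G] [Group K]
    (L : LieAlg G →L[ℝ] LieAlg K) :
    ContMDiff (𝓡 G.dim) (𝓡 K.dim) ∞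
      (fun x : EuclideanSpace ℝ (Fin G.dim) => (L (LieAlg.ofModel x)).toModel) := by
  let L' : EuclideanSpace ℝ (Fin G.dim) →L[ℝ] EuclideanSpace ℝ (Fin K.dim) := L
  exact L'.contMDiff

theorem IsOneForm.map {M : Mfd.{u}} {G : Mfd.{v}} {K : Mfd.{w}} [Group G] [Group K]
    {θ : M.Tan → LieAlg G} (hθ : IsOneForm θ) (L : LieAlg G →L[ℝ] LieAlg K) :
    IsOneForm (fun V => L (θ V)) where
  smooth := (contMDiff_toModel L).comp hθ.smooth
  linear p := ⟨fun v w => by rw [(hθ.linear p).map_add, map_add],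
    fun c v => by rw [(hθ.linear p).map_smul, map_smul]⟩

theorem IsOneForm.add {M : Mfd.{u}} {G : Mfd.{v}} [Group G] {θ η : M.Tan → LieAlg G}
    (hθ : IsOneForm θ) (hη : IsOneForm η) : IsOneForm (fun V => θ V + η V) where
  smooth := ContMDiff.add hθ.smooth hη.smooth
  linear p := ⟨fun v w => by rw [(hθ.linear p).map_add, (hη.linear p).map_add]; abel,
    fun c v => by rw [(hθ.linear p).map_smul, (hη.linear p).map_smul, smul_add]⟩

theorem IsOneForm.neg {M : Mfd.{u}} {G : Mfd.{v}} [Group G] {θ : M.Tan → LieAlg G}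
    (hθ : IsOneForm θ) : IsOneForm (fun V => -θ V) where
  smooth := ContMDiff.neg hθ.smooth
  linear p := ⟨fun v w => by rw [(hθ.linear p).map_add]; abel,
    fun c v => by rw [(hθ.linear p).map_smul, smul_neg]⟩

section Forms

variable {𝔾 : Lie2Group.{w}} {𝕏 : LieGroupoid.{v}}

/-- A `𝔾`-equivariant `L(𝔾)`-valued 1-form on (the total groupoid of) `𝔼`: a morphism of Lie
groupoids `T𝔼 → L(𝔾)` which consists of 1-forms on objects and on morphisms and is equivariant,
where `𝔾` acts on `T𝔼` by the differential of its action on `𝔼`, and on `L(𝔾)` from the right by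
`A · g = Ad(g⁻¹) A`. -/
@[ext]
structure EquivariantForm (𝔼 : Principal2Bundle.{u} 𝔾 𝕏) where
  ob : 𝔼.total.Ob.Tan → LieAlg 𝔾.Ob
  mor : 𝔼.total.Mor.Tan → LieAlg 𝔾.Mor
  isOneForm_ob : IsOneForm ob
  isOneForm_mor : IsOneForm mor
  map_src : ∀ X, 𝔾.lieSrc (mor X) = ob (tan 𝔼.total.src X)
  map_tgt : ∀ X, 𝔾.lieTgt (mor X) = ob (tan 𝔼.total.tgt X)
  map_unit : ∀ V, mor (tan 𝔼.total.unit V) = 𝔾.lieUnit (ob V)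
  map_comp : ∀ X₂ X₁, tan 𝔼.total.src X₂ = tan 𝔼.total.tgt X₁ →
    mor (𝔼.total.tanComp X₂ X₁) = 𝔾.lieComp (mor X₂) (mor X₁)
  equivariant_ob : ∀ (V : 𝔼.total.Ob.Tan) (g : 𝔾.Ob),
    ob (tan (fun p => 𝔼.act.ob p g) V) = lieAd g⁻¹ (ob V)
  equivariant_mor : ∀ (X : 𝔼.total.Mor.Tan) (k : 𝔾.Mor),
    mor (tan (fun γ => 𝔼.act.mor γ k) X) = lieAd k⁻¹ (mor X)

namespace EquivariantForm

variable {𝔼 : Principal2Bundle.{u} 𝔾 𝕏}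

/-- A morphism `Ω ⟹ Ω'` of equivariant 1-forms: a natural transformation `η` of functors
`T𝔼 → L(𝔾)` (automatically invertible, as `L(𝔾)` is a groupoid) which is a smooth 1-form on the
manifold of objects and is `𝔾`-equivariant, `η((p, v) · g) = η(p, v) · 1_g`. -/
@[ext]
structure Hom (Ω Ω' : EquivariantForm 𝔼) where
  app : 𝔼.total.Ob.Tan → LieAlg 𝔾.Mor
  isOneForm : IsOneForm app
  src_app : ∀ V, 𝔾.lieSrc (app V) = Ω.ob V
  tgt_app : ∀ V, 𝔾.lieTgt (app V) = Ω'.ob V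
  natural : ∀ X, 𝔾.lieComp (app (tan 𝔼.total.tgt X)) (Ω.mor X) =
    𝔾.lieComp (Ω'.mor X) (app (tan 𝔼.total.src X))
  equivariant : ∀ (V : 𝔼.total.Ob.Tan) (g : 𝔾.Ob),
    app (tan (fun p => 𝔼.act.ob p g) V) = lieAd (𝔾.unit g)⁻¹ (app V)

/-- The identity natural transformation. -/
def idHom (Ω : EquivariantForm 𝔼) : Hom Ω Ω where
  app V := 𝔾.lieUnit (Ω.ob V)
  isOneForm := Ω.isOneForm_ob.map 𝔾.lieUnit
  src_app V := lieSrc_lieUnit 𝔾 _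
  tgt_app V := lieTgt_lieUnit 𝔾 _
  natural X := by rw [← Ω.map_tgt, lieUnit_lieComp, ← Ω.map_src, lieComp_lieUnit]
  equivariant V g := by rw [Ω.equivariant_ob, lieUnit_lieAd, unit_inv]

/-- Vertical composition: `(θ ∘ η)(p, v) = θ(p, v) ∘ η(p, v)`, the composition of `L(𝔾)`. -/
def vcomp {Ω₁ Ω₂ Ω₃ : EquivariantForm 𝔼} (η : Hom Ω₁ Ω₂) (θ : Hom Ω₂ Ω₃) : Hom Ω₁ Ω₃ where
  app V := 𝔾.lieComp (θ.app V) (η.app V)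
  isOneForm := by
    have h : (fun V => 𝔾.lieComp (θ.app V) (η.app V)) =
        fun V => (θ.app V + η.app V) + -𝔾.lieUnit (𝔾.lieTgt (η.app V)) := funext fun V => by
      rw [lieComp_eq 𝔾 (by rw [θ.src_app, η.tgt_app]), sub_eq_add_neg]
    rw [h]
    exact (θ.isOneForm.add η.isOneForm).add ((η.isOneForm.map 𝔾.lieTgt).map 𝔾.lieUnit).neg
  src_app V := by rw [lieSrc_lieComp 𝔾 (by rw [θ.src_app, η.tgt_app]), η.src_app]
  tgt_app V := by rw [lieTgt_lieComp 𝔾 (by rw [θ.src_app, η.tgt_app]), θ.tgt_app]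
  natural X := by
    rw [lieComp_assoc, η.natural, ← lieComp_assoc, θ.natural, lieComp_assoc]
    all_goals simp only [θ.src_app, θ.tgt_app, η.src_app, η.tgt_app, Ω₁.map_tgt, Ω₂.map_src,
      Ω₂.map_tgt, Ω₃.map_src]
  equivariant V g := by
    have h : 𝔾.lieSrc (θ.app V) = 𝔾.lieTgt (η.app V) := by rw [θ.src_app, η.tgt_app]
    rw [η.equivariant, θ.equivariant, ← unit_inv, lieComp_eq 𝔾 h,
      lieComp_eq 𝔾 (by rw [lieSrc_lieAd, lieTgt_lieAd, h, 𝔾.src_unit, 𝔾.tgt_unit]),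
      lieTgt_lieAd, lieUnit_lieAd, map_sub, map_add, 𝔾.tgt_unit]

/-- The category of `𝔾`-equivariant `L(𝔾)`-valued 1-forms on `𝔼`. -/
instance : Category.{u} (EquivariantForm 𝔼) where
  Hom := Hom
  id := idHom
  comp := vcomp
  id_comp {Ω Ω'} η := Hom.ext <| funext fun V => by
    change 𝔾.lieComp (η.app V) (𝔾.lieUnit (Ω.ob V)) = η.app V
    rw [← η.src_app, lieComp_lieUnit]
  comp_id {Ω Ω'} η := Hom.ext <| funext fun V => by
    change 𝔾.lieComp (𝔾.lieUnit (Ω'.ob V)) (η.app V) = η.app V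
    rw [← η.tgt_app, lieUnit_lieComp]
  assoc η θ ζ := Hom.ext <| funext fun V => by
    change 𝔾.lieComp (ζ.app V) (𝔾.lieComp (θ.app V) (η.app V)) =
      𝔾.lieComp (𝔾.lieComp (ζ.app V) (θ.app V)) (η.app V)
    rw [lieComp_assoc]
    · rw [ζ.src_app, θ.tgt_app]
    · rw [θ.src_app, η.tgt_app]

end EquivariantForm

/-! ## Strict and semi-strict connection 1-forms -/

section Connections

variable (𝔼 : Principal2Bundle.{u} 𝔾 𝕏)

/-- The functor `δ : 𝔼 × L(𝔾) → T𝔼` on objects: `δ(p, B)` is the value at `p` of the fundamental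
vector field of `B`, i.e. the image of `B ∈ T₁G₀` under the differential of `g ↦ p g`. -/
def Principal2Bundle.fundOb (p : 𝔼.total.Ob) (B : LieAlg 𝔾.Ob) : 𝔼.total.Ob.Tan :=
  tan (𝔼.act.ob p) ⟨1, B⟩

/-- The functor `δ : 𝔼 × L(𝔾) → T𝔼` on morphisms. -/
def Principal2Bundle.fundMor (γ : 𝔼.total.Mor) (K : LieAlg 𝔾.Mor) : 𝔼.total.Mor.Tan :=
  tan (𝔼.act.mor γ) ⟨1, K⟩

/-- `Ω` is a strict connection 1-form: `Ω ∘ δ = pr₂` as functors `𝔼 × L(𝔾) → L(𝔾)`. -/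
def IsStrict : ObjectProperty (EquivariantForm 𝔼) := fun Ω =>
  (∀ p B, Ω.ob (𝔼.fundOb p B) = B) ∧ ∀ γ K, Ω.mor (𝔼.fundMor γ K) = K

/-- A `𝔾`-equivariant, fibrewise linear smooth natural isomorphism `κ : Ω ∘ δ ⟹ pr₂` of functors
`𝔼 × L(𝔾) → L(𝔾)`. -/
structure EquivariantForm.VerticalIso {𝔼 : Principal2Bundle.{u} 𝔾 𝕏} (Ω : EquivariantForm 𝔼)
    (κ : 𝔼.total.Ob → LieAlg 𝔾.Ob → LieAlg 𝔾.Mor) : Prop where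
  smooth : ContMDiff ((𝓡 𝔼.total.Ob.dim).prod (𝓡 𝔾.Ob.dim)) (𝓡 𝔾.Mor.dim) ∞
    (fun x : 𝔼.total.Ob × EuclideanSpace ℝ (Fin 𝔾.Ob.dim) =>
      (κ x.1 (LieAlg.ofModel x.2)).toModel)
  linear : ∀ p, IsLinearMap ℝ (κ p)
  src_app : ∀ p B, 𝔾.lieSrc (κ p B) = Ω.ob (𝔼.fundOb p B)
  tgt_app : ∀ p B, 𝔾.lieTgt (κ p B) = B
  natural : ∀ γ K, 𝔾.lieComp (κ (𝔼.total.tgt γ) (𝔾.lieTgt K)) (Ω.mor (𝔼.fundMor γ K)) =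
    𝔾.lieComp K (κ (𝔼.total.src γ) (𝔾.lieSrc K))
  equivariant : ∀ p B g, κ (𝔼.act.ob p g) (lieAd g⁻¹ B) = lieAd (𝔾.unit g)⁻¹ (κ p B)

/-- `Ω` is a semi-strict connection 1-form: `Ω ∘ δ` and `pr₂` are related by a `𝔾`-equivariant,
fibrewise linear natural isomorphism. -/
def IsSemiStrict : ObjectProperty (EquivariantForm 𝔼) := fun Ω => ∃ κ, Ω.VerticalIso κ

theorem isStrict_le_isSemiStrict : IsStrict 𝔼 ≤ IsSemiStrict 𝔼 := by
  rintro Ω ⟨h₀, h₁⟩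
  refine ⟨fun _ B => 𝔾.lieUnit B, ?_, fun p => ⟨map_add _, map_smul _⟩, fun p B => ?_,
    fun p B => lieTgt_lieUnit 𝔾 B, fun γ K => ?_, fun p B g => ?_⟩
  · exact (contMDiff_toModel 𝔾.lieUnit).comp contMDiff_snd
  · rw [h₀, lieSrc_lieUnit]
  · rw [h₁, lieUnit_lieComp, lieComp_lieUnit]
  · rw [lieUnit_lieAd, unit_inv]

/-- The category of strict connection 1-forms on `𝔼`. -/
abbrev StrictConnections := (IsStrict 𝔼).FullSubcategory

/-- The category of semi-strict connection 1-forms on `𝔼`. -/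
abbrev SemiStrictConnections := (IsSemiStrict 𝔼).FullSubcategory

/-- The inclusion of the strict connection 1-forms into the semi-strict ones. -/
abbrev strictInclusion : StrictConnections 𝔼 ⥤ SemiStrictConnections 𝔼 :=
  ObjectProperty.ιOfLE (isStrict_le_isSemiStrict 𝔼)

end Connections

end Forms

end

-- The action is whiskering with the tangent 2-functor. A gauge transformation `F` acts by
-- precomposition with the differential of `K = F⁻¹`, and a 2-morphism acts by the horizontal
-- composite of a morphism of forms with the differential of its horizontal inverse. Precomposition
-- is contravariant, so inserting inverses makes the action a left one.
--
-- The one analytic point is that differentials are functorial for the composition of tangent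
-- groupoids (`LieFunctor.tan_tanComp`). That composition is a derivative within the set of
-- composable pairs, where a derivative is only determined on vectors tangent to the set. Because
-- the source map is a submersion, the set is locally the image of a retraction whose differential
-- fixes those vectors (`exists_fibreProduct_retraction`). Pulling two candidate derivatives back
-- along the retraction turns them into ordinary derivatives, which are unique. When a smooth map
-- into composable pairs is already given, the chain rule suffices (`tanComp_tan`).
--
-- The rest is 2-categorical algebra. By `mor_tan_comp`, a form sends a pointwise composite of
-- arrow-valued maps to a composite in `L(𝔾)`, so identities between gauge 2-morphisms become
-- identities between forms. The identities needed are those for horizontal inverses of identities,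
-- of vertical composites and of horizontal composites. Functoriality is then the interchange law,
-- which follows from naturality of the morphism of forms, and the action law is associativity.
-- Smoothness and equivariance of composites come from `lieComp_eq`, which writes composition in
-- `L(𝔾)` through addition and linear maps.
--
-- An equivariant map carries fundamental vectors to fundamental vectors, so both kinds of
-- connection are stable under precomposition. One construction for an arbitrary stable full
-- subcategory gives both actions.

universe x

noncomputable section

/-! ### Differentials of smooth maps and pullback of 1-forms. -/

section TangentMaps

/-- Every tangent space is definitionally the model space, so vectors at base points that are only
propositionally equal can be compared there without transport. -/
theorem Mfd.Tan.ext {M : Mfd.{u}} {V W : M.Tan} (h : V.proj = W.proj)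
    (h' : (V.2 : EuclideanSpace ℝ (Fin M.dim)) = W.2) : V = W := by
  obtain ⟨p, v⟩ := V
  obtain ⟨q, w⟩ := W
  obtain rfl : p = q := h
  obtain rfl : v = w := h'
  rfl

theorem IsSmooth.hasMFDerivAt {M : Mfd.{u}} {N : Mfd.{v}} {f : M → N} (hf : IsSmooth f) (p : M) :
    HasMFDerivAt (𝓡 M.dim) (𝓡 N.dim) f p (mfderiv (𝓡 M.dim) (𝓡 N.dim) f p) :=
  (hf.mdifferentiableAt (by simp)).hasMFDerivAt

theorem tan_tan {M : Mfd.{u}} {N : Mfd.{v}} {P : Mfd.{w}} {g : N → P} {f : M → N}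
    (hg : IsSmooth g) (hf : IsSmooth f) (V : M.Tan) : tan g (tan f V) = tan (g ∘ f) V :=
  (tangentMap_comp_at V (hg.mdifferentiableAt (by simp)) (hf.mdifferentiableAt (by simp))).symm

theorem tan_id {M : Mfd.{u}} (V : M.Tan) : tan (id : M → M) V = V :=
  congrFun tangentMap_id V

theorem IsOneForm.comp_tan {M : Mfd.{u}} {N : Mfd.{v}} {G : Mfd.{w}} [Group G]
    {θ : N.Tan → LieAlg G} (hθ : IsOneForm θ) {f : M → N} (hf : IsSmooth f) :
    IsOneForm (fun V => θ (tan f V)) where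
  smooth := hθ.smooth.comp (ContMDiff.contMDiff_tangentMap hf (by simp))
  linear p :=
    { map_add := fun v w =>
        (congrArg (fun x : EuclideanSpace ℝ (Fin N.dim) => θ ⟨f p, x⟩)
          (map_add (mfderiv (𝓡 M.dim) (𝓡 N.dim) f p) v w)).trans ((hθ.linear (f p)).map_add _ _)
      map_smul := fun c v =>
        (congrArg (fun x : EuclideanSpace ℝ (Fin N.dim) => θ ⟨f p, x⟩)
          (map_smul (mfderiv (𝓡 M.dim) (𝓡 N.dim) f p) c v)).trans
            ((hθ.linear (f p)).map_smul _ _) }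

end TangentMaps

/-! ### Composition in the tangent groupoid. -/

namespace LieGroupoid

variable (𝕏 : LieGroupoid.{u})

/-- Composition is smooth only along the composable pairs, a set that need not determine derivatives
uniquely. This provides a valid derivative, whose values away from tangent vectors are an arbitrary
choice. -/
theorem hasMFDerivWithinAt_comp {γ₂ γ₁ : 𝕏.Mor} (h : 𝕏.src γ₂ = 𝕏.tgt γ₁) :
    HasMFDerivWithinAt ((𝓡 𝕏.Mor.dim).prod (𝓡 𝕏.Mor.dim)) (𝓡 𝕏.Mor.dim)
      (fun x : 𝕏.Mor × 𝕏.Mor => 𝕏.comp x.1 x.2) 𝕏.composable (γ₂, γ₁)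
      (mfderivWithin ((𝓡 𝕏.Mor.dim).prod (𝓡 𝕏.Mor.dim)) (𝓡 𝕏.Mor.dim)
        (fun x : 𝕏.Mor × 𝕏.Mor => 𝕏.comp x.1 x.2) 𝕏.composable (γ₂, γ₁)) :=
  (𝕏.smooth_comp.mdifferentiableOn (by simp) (γ₂, γ₁) h).hasMFDerivWithinAt

/-- The tangent composition of `a_* V` and `b_* V` is the differential of `p ↦ a p ∘ b p`. -/
theorem tanComp_tan {M : Mfd.{v}} {a b : M → 𝕏.Mor} (ha : IsSmooth a) (hb : IsSmooth b)
    (hab : ∀ p, 𝕏.src (a p) = 𝕏.tgt (b p)) (V : M.Tan) :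
    𝕏.tanComp (tan a V) (tan b V) = tan (fun p => 𝕏.comp (a p) (b p)) V := by
  have hp := ((ha.hasMFDerivAt V.proj).prodMk (hb.hasMFDerivAt V.proj)).hasMFDerivWithinAt
    (s := Set.univ)
  -- All of `M` is mapped into the composable pairs, so the chain rule gives a derivative within
  -- `Set.univ`, which is an ordinary one.
  have hsub : Set.univ ⊆ (fun x => (a x, b x)) ⁻¹' 𝕏.composable := fun x _ => hab x
  have h := HasMFDerivWithinAt.comp V.proj (𝕏.hasMFDerivWithinAt_comp (hab V.proj)) hp hsub
  rw [hasMFDerivWithinAt_univ] at h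
  refine Mfd.Tan.ext rfl ?_
  exact (congrArg (fun D : EuclideanSpace ℝ (Fin M.dim) →L[ℝ]
    EuclideanSpace ℝ (Fin 𝕏.Mor.dim) => D V.2) h.mfderiv).symm

end LieGroupoid

open Filter Topology in
/-- The fibre product of a submersion `f` and a smooth map `g` is locally the image of a retraction
`z ↦ (r z, z.2)` whose differential fixes the vectors tangent to the fibre product. -/
theorem exists_fibreProduct_retraction {M : Mfd.{u}} {N : Mfd.{v}} {P : Mfd.{w}} {f : M → N}
    {g : P → N} (hf : Manifold.IsSubmersion (𝓡 M.dim) (𝓡 N.dim) ∞ f) (hg : IsSmooth g)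
    {x : M} {y : P} (hxy : f x = g y) :
    ∃ (r : M × P → M) (D : EuclideanSpace ℝ (Fin M.dim) × EuclideanSpace ℝ (Fin P.dim) →L[ℝ]
        EuclideanSpace ℝ (Fin M.dim)),
      r (x, y) = x ∧ HasMFDerivAt ((𝓡 M.dim).prod (𝓡 P.dim)) (𝓡 M.dim) r (x, y) D ∧
      (∀ᶠ z in 𝓝 (x, y), f (r z) = g z.2) ∧
      ∀ (v : EuclideanSpace ℝ (Fin M.dim)) (w : EuclideanSpace ℝ (Fin P.dim)),
        (mfderiv (𝓡 M.dim) (𝓡 N.dim) f x v : EuclideanSpace ℝ (Fin N.dim)) =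
          mfderiv (𝓡 P.dim) (𝓡 N.dim) g y w → D (v, w) = v := by
  have hs := hf.isSubmersionAt x
  let φ := hs.domChart
  let ψ := hs.codChart
  let e := hs.equiv
  have hxφ : x ∈ φ.source := hs.mem_domChart_source
  have hxψ : f x ∈ ψ.source := hs.mem_codChart_source
  have hφa := IsManifold.maximalAtlas_subset_of_le (m := 1) (n := ∞) (by simp)
    hs.domChart_mem_maximalAtlas
  have hψa := IsManifold.maximalAtlas_subset_of_le (m := 1) (n := ∞) (by simp)
    hs.codChart_mem_maximalAtlas
  -- The normal form of a submersion: in these charts `f` is the projection to the first factor.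
  have hw : ∀ z ∈ φ.source, ψ (f z) = (e (φ z)).1 := fun z hz => by
    have h := hs.writtenInCharts (show φ z ∈ (φ.extend (𝓡 M.dim)).target by
      rw [OpenPartialHomeomorph.extend_target]
      exact ⟨φ.map_source hz, by simp⟩)
    change ψ (f (φ.symm (φ z))) = (e (φ z)).1 at h
    rwa [φ.left_inv hz] at h
  let EM := EuclideanSpace ℝ (Fin M.dim)
  let EN := EuclideanSpace ℝ (Fin N.dim)
  let EP := EuclideanSpace ℝ (Fin P.dim)
  let Dφ : EM →L[ℝ] EM := mfderiv (𝓡 M.dim) (𝓡 M.dim) φ x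
  let Dφs : EM →L[ℝ] EM := mfderiv (𝓡 M.dim) (𝓡 M.dim) φ.symm (φ x)
  let Dψ : EN →L[ℝ] EN := mfderiv (𝓡 N.dim) (𝓡 N.dim) ψ (f x)
  let Df : EM →L[ℝ] EN := mfderiv (𝓡 M.dim) (𝓡 N.dim) f x
  let Dg : EP →L[ℝ] EN := mfderiv (𝓡 P.dim) (𝓡 N.dim) g y
  have dφ : HasMFDerivAt (𝓡 M.dim) (𝓡 M.dim) φ x Dφ :=
    (mdifferentiableAt_of_mem_maximalAtlas hφa hxφ).hasMFDerivAt
  have dφs : HasMFDerivAt (𝓡 M.dim) (𝓡 M.dim) φ.symm (φ x) Dφs :=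
    (mdifferentiableAt_symm_of_mem_maximalAtlas hφa (φ.map_source hxφ)).hasMFDerivAt
  have dψ : HasMFDerivAt (𝓡 N.dim) (𝓡 N.dim) ψ (f x) Dψ :=
    (mdifferentiableAt_of_mem_maximalAtlas hψa hxψ).hasMFDerivAt
  have dψ' : HasMFDerivAt (𝓡 N.dim) (𝓡 N.dim) ψ (g y) Dψ := hxy ▸ dψ
  have df : HasMFDerivAt (𝓡 M.dim) (𝓡 N.dim) f x Df :=
    (hf.contMDiff.mdifferentiableAt (by simp)).hasMFDerivAt
  have dg : HasMFDerivAt (𝓡 P.dim) (𝓡 N.dim) g y Dg := hg.hasMFDerivAt y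
  have hid : ∀ v, Dφs (Dφ v) = v := fun v => by
    have h1 := dφs.comp x dφ
    have h2 : HasMFDerivAt (𝓡 M.dim) (𝓡 M.dim) (φ.symm ∘ φ) x (ContinuousLinearMap.id ℝ EM) :=
      (hasMFDerivAt_id x).congr_of_eventuallyEq
        (Filter.eventuallyEq_of_mem (φ.open_source.mem_nhds hxφ) fun z hz => φ.left_inv hz)
    exact congrArg (fun D : EM →L[ℝ] EM => D v) (hasMFDerivAt_unique h1 h2)
  -- The infinitesimal version of the normal form, by differentiating it at `x`.
  have hfst : ∀ v, Dψ (Df v) = (e (Dφ v)).1 := fun v => by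
    have h1 := dψ.comp x df
    have h2 : HasMFDerivAt (𝓡 M.dim) (𝓡 N.dim) (ψ ∘ f) x
        (((ContinuousLinearMap.fst ℝ EN hs.complement).comp e.toContinuousLinearMap).comp Dφ) :=
      (((ContinuousLinearMap.fst ℝ EN hs.complement).comp
        e.toContinuousLinearMap).hasMFDerivAt.comp x dφ).congr_of_eventuallyEq
          (Filter.eventuallyEq_of_mem (φ.open_source.mem_nhds hxφ) hw)
    exact congrArg (fun D : EM →L[ℝ] EN => D v) (hasMFDerivAt_unique h1 h2)
  -- The retraction in charts: the fibre coordinate of `z.1` is kept, and its base coordinate is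
  -- replaced by that of `g z.2`.
  let q : M × P → EM := fun z => e.symm (ψ (g z.2), (e (φ z.1)).2)
  have hq : q (x, y) = φ x := by
    change e.symm (ψ (g y), (e (φ x)).2) = φ x
    rw [← hxy, hw x hxφ]
    exact e.symm_apply_apply _
  let Dq : EM × EP →L[ℝ] EM := e.symm.toContinuousLinearMap.comp
    (((Dψ.comp Dg).comp (ContinuousLinearMap.snd ℝ EM EP)).prod
      (((ContinuousLinearMap.snd ℝ EN hs.complement).comp e.toContinuousLinearMap).comp
        (Dφ.comp (ContinuousLinearMap.fst ℝ EM EP))))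
  have dq : HasMFDerivAt ((𝓡 M.dim).prod (𝓡 P.dim)) (𝓡 M.dim) q (x, y) Dq := by
    have h1 := (dψ'.comp y dg).comp (x, y) (hasMFDerivAt_snd (I := 𝓡 M.dim) (x, y))
    have h2 := dφ.comp (x, y) (hasMFDerivAt_fst (I' := 𝓡 P.dim) (x, y))
    have h3 := ((ContinuousLinearMap.snd ℝ EN hs.complement).comp
      e.toContinuousLinearMap).hasMFDerivAt.comp (x, y) h2
    exact e.symm.toContinuousLinearMap.hasMFDerivAt.comp (x, y)
      ⟨h1.1.prodMk h3.1, h1.2.prodMk h3.2⟩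
  have cq : ContinuousAt q (x, y) := dq.continuousAt
  refine ⟨fun z => φ.symm (q z), Dφs.comp Dq, ?_, ?_, ?_, fun v w' hvw => ?_⟩
  · change φ.symm (q (x, y)) = x
    rw [hq, φ.left_inv hxφ]
  · exact HasMFDerivAt.comp (x, y) (hq ▸ dφs) dq
  -- Near `(x, y)` every point stays inside the chart domains. There `ψ` is injective, and by
  -- construction `f (r z)` and `g z.2` have the same image under `ψ`.
  · have h1 : ∀ᶠ z in 𝓝 (x, y), q z ∈ φ.target :=
      cq (φ.open_target.mem_nhds (hq ▸ φ.map_source hxφ))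
    have h2 : ∀ᶠ z : M × P in 𝓝 (x, y), g z.2 ∈ ψ.source :=
      (hg.continuous.comp continuous_snd).continuousAt
        (ψ.open_source.mem_nhds (show g y ∈ ψ.source from hxy ▸ hxψ))
    filter_upwards [h1, h2] with z hz1 hz2
    have hz3 := φ.map_target hz1
    refine ψ.injOn (hs.source_subset_preimage_source hz3) hz2 ?_
    rw [hw _ hz3, φ.right_inv hz1]
    exact congrArg Prod.fst (e.apply_symm_apply _)
  -- On a vector tangent to the fibre product the replaced coordinate equals the old one, so only
  -- `Dφs (Dφ v)` is left.
  · change Dφs (e.symm (Dψ (Dg w'), (e (Dφ v)).2)) = v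
    have h : Dg w' = Df v := hvw.symm
    rw [h, hfst, Prod.mk.eta, e.symm_apply_apply, hid]

theorem snd_eq_of_tan_eq {M : Mfd.{u}} {N : Mfd.{v}} {P : Mfd.{w}} {f : M → N} {g : P → N}
    {V : M.Tan} {W : P.Tan} (h : tan f V = tan g W) :
    (mfderiv (𝓡 M.dim) (𝓡 N.dim) f V.proj V.2 : EuclideanSpace ℝ (Fin N.dim)) =
      mfderiv (𝓡 P.dim) (𝓡 N.dim) g W.proj W.2 :=
  congrArg (fun U : N.Tan => (U.2 : EuclideanSpace ℝ (Fin N.dim))) h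

/-- The differential of a smooth functor is compatible with the composition of tangent vectors. -/
theorem LieFunctor.tan_tanComp {𝕏 : LieGroupoid.{u}} {𝕐 : LieGroupoid.{v}} (F : LieFunctor 𝕏 𝕐)
    {X₂ X₁ : 𝕏.Mor.Tan} (h : tan 𝕏.src X₂ = tan 𝕏.tgt X₁) :
    tan F.mor (𝕏.tanComp X₂ X₁) = 𝕐.tanComp (tan F.mor X₂) (tan F.mor X₁) := by
  have hp : 𝕏.src X₂.proj = 𝕏.tgt X₁.proj := congrArg Bundle.TotalSpace.proj h
  refine Mfd.Tan.ext (F.map_comp _ _ hp) ?_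
  obtain ⟨r, D, hr, dr, hev, hD⟩ :=
    exists_fibreProduct_retraction 𝕏.submersion_src 𝕏.smooth_tgt hp
  let E := EuclideanSpace ℝ (Fin 𝕏.Mor.dim)
  let E' := EuclideanSpace ℝ (Fin 𝕐.Mor.dim)
  let I := (𝓡 𝕏.Mor.dim).prod (𝓡 𝕏.Mor.dim)
  let x : 𝕏.Mor × 𝕏.Mor := (X₂.proj, X₁.proj)
  let ρ : 𝕏.Mor × 𝕏.Mor → 𝕏.Mor × 𝕏.Mor := fun z => (r z, z.2)
  have hρ : HasMFDerivAt I I ρ x (D.prod (ContinuousLinearMap.snd ℝ E E)) :=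
    dr.prodMk (hasMFDerivAt_snd x)
  have hρx : ρ x = x := Prod.ext hr rfl
  have hF : ∀ γ₂ γ₁, 𝕏.src γ₂ = 𝕏.tgt γ₁ → 𝕐.src (F.mor γ₂) = 𝕐.tgt (F.mor γ₁) := fun γ₂ γ₁ h => by
    rw [F.map_src, F.map_tgt, h]
  have hsub : 𝕏.composable ⊆ Prod.map F.mor F.mor ⁻¹' 𝕐.composable := fun z hz => hF _ _ hz
  -- `A` and `B` are derivatives, within the composable pairs, of two maps that agree on that set.
  -- They need not be equal as linear maps, but they agree on tangent vectors.
  let A : E × E →L[ℝ] E' := (mfderiv (𝓡 𝕏.Mor.dim) (𝓡 𝕐.Mor.dim) F.mor _ : E →L[ℝ] E').comp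
    (mfderivWithin I (𝓡 𝕏.Mor.dim) (fun x : 𝕏.Mor × 𝕏.Mor => 𝕏.comp x.1 x.2) 𝕏.composable x :
      E × E →L[ℝ] E)
  let B : E × E →L[ℝ] E' := (mfderivWithin ((𝓡 𝕐.Mor.dim).prod (𝓡 𝕐.Mor.dim)) (𝓡 𝕐.Mor.dim)
    (fun x : 𝕐.Mor × 𝕐.Mor => 𝕐.comp x.1 x.2) 𝕐.composable (F.mor X₂.proj, F.mor X₁.proj) :
      E' × E' →L[ℝ] E').comp
    ((mfderiv (𝓡 𝕏.Mor.dim) (𝓡 𝕐.Mor.dim) F.mor X₂.proj : E →L[ℝ] E').prodMap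
      (mfderiv (𝓡 𝕏.Mor.dim) (𝓡 𝕐.Mor.dim) F.mor X₁.proj : E →L[ℝ] E'))
  have hA : HasMFDerivWithinAt I (𝓡 𝕐.Mor.dim) (F.mor ∘ fun x : 𝕏.Mor × 𝕏.Mor => 𝕏.comp x.1 x.2)
      𝕏.composable x A :=
    HasMFDerivAt.comp_hasMFDerivWithinAt x (F.smooth_mor.hasMFDerivAt _)
      (𝕏.hasMFDerivWithinAt_comp hp)
  have hB : HasMFDerivWithinAt I (𝓡 𝕐.Mor.dim)
      ((fun x : 𝕐.Mor × 𝕐.Mor => 𝕐.comp x.1 x.2) ∘ Prod.map F.mor F.mor) 𝕏.composable x B :=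
    HasMFDerivWithinAt.comp x (𝕐.hasMFDerivWithinAt_comp (hF _ _ hp))
      ((F.smooth_mor.hasMFDerivAt X₂.proj).prodMap
        (F.smooth_mor.hasMFDerivAt X₁.proj)).hasMFDerivWithinAt hsub
  -- By `hev` the preimage of the composable pairs under `ρ` is a neighbourhood of `x`, so composing
  -- with `ρ` gives a derivative in the full sense.
  have hA' := (HasMFDerivWithinAt.comp x (hρx.symm ▸ hA)
    (hρ.hasMFDerivWithinAt (s := ρ ⁻¹' 𝕏.composable)) subset_rfl).hasMFDerivAt hev
  have hB' := (HasMFDerivWithinAt.comp x (hρx.symm ▸ hB)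
    (hρ.hasMFDerivWithinAt (s := ρ ⁻¹' 𝕏.composable)) subset_rfl).hasMFDerivAt hev
  have hAB := hasMFDerivAt_unique (hA'.congr_of_eventuallyEq
    (Filter.eventuallyEq_of_mem hev fun z hz => (F.map_comp _ _ hz).symm)) hB'
  -- The hypothesis `h` says that the pair is tangent to the composable pairs, so the retraction
  -- fixes it.
  have hv : D (X₂.2, X₁.2) = X₂.2 := hD _ _ (snd_eq_of_tan_eq h)
  have key : A (D (X₂.2, X₁.2), X₁.2) = B (D (X₂.2, X₁.2), X₁.2) :=
    congrArg (fun T : E × E →L[ℝ] E' => T (X₂.2, X₁.2)) hAB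
  rw [hv] at key
  exact key

/-- Transfers each commuting square of structure maps, functors or actions to tangent bundles. -/
theorem tan_tan_comm {M : Mfd.{u}} {N : Mfd.{v}} {P : Mfd.{w}} {Q : Mfd.{x}} {f : M → N}
    {g : N → Q} {f' : M → P} {g' : P → Q} (hg : IsSmooth g) (hf : IsSmooth f) (hg' : IsSmooth g')
    (hf' : IsSmooth f') (h : ∀ p, g (f p) = g' (f' p)) (V : M.Tan) :
    tan g (tan f V) = tan g' (tan f' V) := by
  rw [tan_tan hg hf, tan_tan hg' hf', show g ∘ f = g' ∘ f' from funext h]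

/-! ### Differentials of functors and of actions. -/

namespace LieFunctor

variable {𝕏 : LieGroupoid.{u}} {𝕐 : LieGroupoid.{v}} (F : LieFunctor 𝕏 𝕐)

theorem tan_src (X : 𝕏.Mor.Tan) : tan 𝕐.src (tan F.mor X) = tan F.ob (tan 𝕏.src X) :=
  tan_tan_comm 𝕐.smooth_src F.smooth_mor F.smooth_ob 𝕏.smooth_src F.map_src X

theorem tan_tgt (X : 𝕏.Mor.Tan) : tan 𝕐.tgt (tan F.mor X) = tan F.ob (tan 𝕏.tgt X) :=
  tan_tan_comm 𝕐.smooth_tgt F.smooth_mor F.smooth_ob 𝕏.smooth_tgt F.map_tgt X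

theorem tan_unit (V : 𝕏.Ob.Tan) : tan F.mor (tan 𝕏.unit V) = tan 𝕐.unit (tan F.ob V) :=
  tan_tan_comm F.smooth_mor 𝕏.smooth_unit 𝕐.smooth_unit F.smooth_ob F.map_unit V

end LieFunctor

namespace LieAction

variable {𝔼 : LieGroupoid.{u}} {𝔾 : Lie2Group.{w}} (ρ : LieAction 𝔼 𝔾)

theorem smooth_ob_left (g : 𝔾.Ob) : IsSmooth (fun p => ρ.ob p g) :=
  ρ.smooth_ob.comp (contMDiff_id.prodMk contMDiff_const)

theorem smooth_ob_right (p : 𝔼.Ob) : IsSmooth (ρ.ob p) :=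
  ρ.smooth_ob.comp (contMDiff_const.prodMk contMDiff_id)

theorem smooth_mor_left (k : 𝔾.Mor) : IsSmooth (fun γ => ρ.mor γ k) :=
  ρ.smooth_mor.comp (contMDiff_id.prodMk contMDiff_const)

theorem smooth_mor_right (γ : 𝔼.Mor) : IsSmooth (ρ.mor γ) :=
  ρ.smooth_mor.comp (contMDiff_const.prodMk contMDiff_id)

end LieAction

/-! ### Inverses in a groupoid and horizontal inverses of gauge 2-morphisms. -/

namespace LieGroupoid

variable (𝕏 : LieGroupoid.{u})

theorem inv_comp_rev {γ₂ γ₁ : 𝕏.Mor} (h : 𝕏.src γ₂ = 𝕏.tgt γ₁) :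
    𝕏.inv (𝕏.comp γ₂ γ₁) = 𝕏.comp (𝕏.inv γ₁) (𝕏.inv γ₂) := by
  have h' : 𝕏.src (𝕏.inv γ₁) = 𝕏.tgt (𝕏.inv γ₂) := by rw [𝕏.src_inv, 𝕏.tgt_inv, h]
  symm
  apply 𝕏.eq_inv_of_comp
  · rw [𝕏.src_comp _ _ h', 𝕏.src_inv, 𝕏.tgt_comp _ _ h]
  · rw [𝕏.comp_assoc _ _ _ h' (by rw [𝕏.src_inv, 𝕏.tgt_comp _ _ h]),
      ← 𝕏.comp_assoc _ _ _ (𝕏.src_inv γ₂) h, 𝕏.inv_comp, h, 𝕏.unit_comp, 𝕏.inv_comp,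
      𝕏.src_comp _ _ h]

/-- A commutative square in a groupoid, with two opposite sides inverted. -/
theorem inv_comp_eq_comp_inv {α β γ δ : 𝕏.Mor} (hαβ : 𝕏.src α = 𝕏.tgt β)
    (hγδ : 𝕏.src γ = 𝕏.tgt δ) (h : 𝕏.comp α β = 𝕏.comp γ δ) :
    𝕏.comp (𝕏.inv γ) α = 𝕏.comp δ (𝕏.inv β) := by
  have hγα : 𝕏.tgt γ = 𝕏.tgt α := by rw [← 𝕏.tgt_comp _ _ hγδ, ← h, 𝕏.tgt_comp _ _ hαβ]
  have h1 : 𝕏.src (𝕏.inv γ) = 𝕏.tgt α := by rw [𝕏.src_inv, hγα]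
  have h2 : 𝕏.src (𝕏.comp (𝕏.inv γ) α) = 𝕏.tgt β := by rw [𝕏.src_comp _ _ h1, hαβ]
  have h3 : 𝕏.comp (𝕏.comp (𝕏.inv γ) α) β = δ := by
    rw [𝕏.comp_assoc _ _ _ h1 hαβ, h, ← 𝕏.comp_assoc _ _ _ (𝕏.src_inv γ) hγδ, 𝕏.inv_comp, hγδ,
      𝕏.unit_comp]
  rw [← h3, 𝕏.comp_assoc _ _ _ h2 (𝕏.tgt_inv β).symm, 𝕏.comp_inv, ← h2, 𝕏.comp_unit]

end LieGroupoid

section GaugeInverses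

variable {𝔾 : Lie2Group.{w}} {𝕏 : LieGroupoid.{v}} {𝔼 : Principal2Bundle.{u} 𝔾 𝕏}

namespace Gauge

theorem hinv_app {F F' : Gauge 𝔼} (Φ : F ⟶ F') (p : 𝔼.total.Ob) :
    Hom.app (hinv Φ) p = 𝔼.total.inv (F⁻¹.val.mor (Hom.app Φ (F'⁻¹.val.ob p))) := rfl

theorem hinv_id_app (F : Gauge 𝔼) (p : 𝔼.total.Ob) :
    Hom.app (hinv (𝟙 F)) p = 𝔼.total.unit (F⁻¹.val.ob p) := by
  rw [hinv_app, id_app, ob_inv_ob, F⁻¹.val.map_unit]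
  symm
  apply 𝔼.total.eq_inv_of_comp
  · rw [𝔼.total.src_unit, 𝔼.total.tgt_unit]
  · have h := 𝔼.total.comp_unit (𝔼.total.unit (F⁻¹.val.ob p))
    rw [𝔼.total.src_unit] at h ⊢
    exact h

/-- The horizontal inverse of a vertical composite. -/
theorem hinv_comp_app {F F' F'' : Gauge 𝔼} (Φ : F ⟶ F') (Ψ : F' ⟶ F'') (p : 𝔼.total.Ob) :
    Hom.app (hinv (Φ ≫ Ψ)) p = 𝔼.total.comp (Hom.app (hinv Ψ) p) (Hom.app (hinv Φ) p) := by
  -- The formula for `hinv` reverses the order of the two factors. Naturality of `hinv Φ` at this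
  -- arrow gives the square that, with two opposite sides inverted, restores the order.
  have hn := Hom.natural (hinv Φ) (Hom.app Ψ (F''⁻¹.val.ob p))
  rw [Ψ.tgt_app, Ψ.src_app, ob_inv_ob] at hn
  rw [hinv_app (Φ ≫ Ψ), comp_app, F⁻¹.val.map_comp _ _ (by rw [Ψ.src_app, Φ.tgt_app]),
    𝔼.total.inv_comp_rev
      (by rw [F⁻¹.val.map_src, F⁻¹.val.map_tgt, Ψ.src_app, Φ.tgt_app]), hinv_app Ψ]
  have h := 𝔼.total.inv_comp_eq_comp_inv
    (by rw [Hom.src_app, F⁻¹.val.map_tgt, Ψ.tgt_app, ob_inv_ob])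
    (by rw [Hom.tgt_app, F'⁻¹.val.map_src, Ψ.src_app]) hn
  rw [hinv_app Φ (F'.val.ob _), inv_ob_ob] at h
  exact h.symm

/-- The horizontal inverse of a horizontal composite. -/
theorem hinv_hcomp_app {F F' K K' : Gauge 𝔼} (Φ : F ⟶ F') (Ψ : K ⟶ K') (p : 𝔼.total.Ob) :
    Hom.app (hinv (hcomp Φ Ψ)) p = 𝔼.total.comp (Hom.app (hinv Ψ) (F'⁻¹.val.ob p))
      (K⁻¹.val.mor (Hom.app (hinv Φ) p)) := by
  change 𝔼.total.inv (K⁻¹.val.mor (F⁻¹.val.mor (𝔼.total.comp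
    (Φ.app (K'.val.ob (K'⁻¹.val.ob (F'⁻¹.val.ob p))))
    (F.val.mor (Ψ.app (K'⁻¹.val.ob (F'⁻¹.val.ob p))))))) = _
  have h : 𝔼.total.src (Φ.app (F'⁻¹.val.ob p)) =
      𝔼.total.tgt (F.val.mor (Ψ.app (K'⁻¹.val.ob (F'⁻¹.val.ob p)))) := by
    rw [Φ.src_app, F.val.map_tgt, Ψ.tgt_app, ob_inv_ob]
  have h1 : 𝔼.total.src (F⁻¹.val.mor (Φ.app (F'⁻¹.val.ob p))) =
      𝔼.total.tgt (Ψ.app (K'⁻¹.val.ob (F'⁻¹.val.ob p))) := by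
    rw [F⁻¹.val.map_src, h, F.val.map_tgt, inv_ob_ob]
  rw [ob_inv_ob, F⁻¹.val.map_comp _ _ h, inv_mor_mor, K⁻¹.val.map_comp _ _ h1,
    𝔼.total.inv_comp_rev (by rw [K⁻¹.val.map_src, K⁻¹.val.map_tgt, h1]), hinv_app, hinv_app,
    K⁻¹.val.map_inv]

theorem Hom.tan_src_app {F F' : Gauge 𝔼} (Φ : Hom F F') (V : 𝔼.total.Ob.Tan) :
    tan 𝔼.total.src (tan Φ.app V) = tan F.val.ob V :=
  (tan_tan 𝔼.total.smooth_src Φ.smooth V).trans (congrArg (tan · V) (funext Φ.src_app))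

theorem Hom.tan_tgt_app {F F' : Gauge 𝔼} (Φ : Hom F F') (V : 𝔼.total.Ob.Tan) :
    tan 𝔼.total.tgt (tan Φ.app V) = tan F'.val.ob V :=
  (tan_tan 𝔼.total.smooth_tgt Φ.smooth V).trans (congrArg (tan · V) (funext Φ.tgt_app))

end Gauge

end GaugeInverses

/-! ### Pullback of equivariant 1-forms and of their morphisms. -/

section GaugeAction

variable {𝔾 : Lie2Group.{w}} {𝕏 : LieGroupoid.{v}} {𝔼 : Principal2Bundle.{u} 𝔾 𝕏}

namespace BundleEnd

variable (K : BundleEnd 𝔼)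

theorem tan_act_ob (g : 𝔾.Ob) (V : 𝔼.total.Ob.Tan) :
    tan K.ob (tan (fun p => 𝔼.act.ob p g) V) = tan (fun p => 𝔼.act.ob p g) (tan K.ob V) :=
  tan_tan_comm K.smooth_ob (𝔼.act.smooth_ob_left g) (𝔼.act.smooth_ob_left g) K.smooth_ob
    (fun p => K.equivariant_ob p g) V

theorem tan_act_mor (k : 𝔾.Mor) (X : 𝔼.total.Mor.Tan) :
    tan K.mor (tan (fun γ => 𝔼.act.mor γ k) X) = tan (fun γ => 𝔼.act.mor γ k) (tan K.mor X) :=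
  tan_tan_comm K.smooth_mor (𝔼.act.smooth_mor_left k) (𝔼.act.smooth_mor_left k) K.smooth_mor
    (fun γ => K.equivariant_mor γ k) X

/-- Equivariance says that `K` sends the orbit map of `p` to the orbit map of `K.ob p`, and
fundamental vectors are derivatives of orbit maps. -/
theorem tan_fundOb (p : 𝔼.total.Ob) (B : LieAlg 𝔾.Ob) :
    tan K.ob (𝔼.fundOb p B) = 𝔼.fundOb (K.ob p) B := by
  refine (tan_tan K.smooth_ob (𝔼.act.smooth_ob_right p) _).trans ?_
  rw [show K.ob ∘ 𝔼.act.ob p = 𝔼.act.ob (K.ob p) from funext (K.equivariant_ob p)]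
  rfl

theorem tan_fundMor (γ : 𝔼.total.Mor) (A : LieAlg 𝔾.Mor) :
    tan K.mor (𝔼.fundMor γ A) = 𝔼.fundMor (K.mor γ) A := by
  refine (tan_tan K.smooth_mor (𝔼.act.smooth_mor_right γ) _).trans ?_
  rw [show K.mor ∘ 𝔼.act.mor γ = 𝔼.act.mor (K.mor γ) from funext (K.equivariant_mor γ)]
  rfl

end BundleEnd

namespace EquivariantForm

/-- The equivariant 1-form `Ω ∘ K_*`. -/
def precomp (K : BundleEnd 𝔼) (Ω : EquivariantForm 𝔼) : EquivariantForm 𝔼 where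
  ob V := Ω.ob (tan K.ob V)
  mor X := Ω.mor (tan K.mor X)
  isOneForm_ob := Ω.isOneForm_ob.comp_tan K.smooth_ob
  isOneForm_mor := Ω.isOneForm_mor.comp_tan K.smooth_mor
  map_src X := by rw [Ω.map_src, K.tan_src]
  map_tgt X := by rw [Ω.map_tgt, K.tan_tgt]
  map_unit V := by rw [K.tan_unit, Ω.map_unit]
  map_comp X₂ X₁ h := by
    rw [K.tan_tanComp h, Ω.map_comp _ _ (by rw [K.tan_src, K.tan_tgt, h])]
  equivariant_ob V g := by rw [K.tan_act_ob, Ω.equivariant_ob]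
  equivariant_mor X k := by rw [K.tan_act_mor, Ω.equivariant_mor]

theorem precomp_one (Ω : EquivariantForm 𝔼) : Ω.precomp 1 = Ω :=
  EquivariantForm.ext (funext fun V => congrArg Ω.ob (tan_id V))
    (funext fun X => congrArg Ω.mor (tan_id X))

theorem precomp_mul (K L : BundleEnd 𝔼) (Ω : EquivariantForm 𝔼) :
    Ω.precomp (K * L) = (Ω.precomp K).precomp L :=
  EquivariantForm.ext (funext fun V => congrArg Ω.ob (tan_tan K.smooth_ob L.smooth_ob V).symm)
    (funext fun X => congrArg Ω.mor (tan_tan K.smooth_mor L.smooth_mor X).symm)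

theorem src_mor_app (Ω : EquivariantForm 𝔼) {F F' : Gauge 𝔼} (Ψ : Gauge.Hom F F')
    (V : 𝔼.total.Ob.Tan) : 𝔾.lieSrc (Ω.mor (tan Ψ.app V)) = Ω.ob (tan F.val.ob V) := by
  rw [Ω.map_src, Ψ.tan_src_app]

theorem tgt_mor_app (Ω : EquivariantForm 𝔼) {F F' : Gauge 𝔼} (Ψ : Gauge.Hom F F')
    (V : 𝔼.total.Ob.Tan) : 𝔾.lieTgt (Ω.mor (tan Ψ.app V)) = Ω.ob (tan F'.val.ob V) := by
  rw [Ω.map_tgt, Ψ.tan_tgt_app]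

/-- `Ω` applied to the differential of a pointwise composite. -/
theorem mor_tan_comp (Ω : EquivariantForm 𝔼) {M : Mfd.{x}} {a b : M → 𝔼.total.Mor}
    (ha : IsSmooth a) (hb : IsSmooth b) (hab : ∀ p, 𝔼.total.src (a p) = 𝔼.total.tgt (b p))
    (V : M.Tan) :
    Ω.mor (tan (fun p => 𝔼.total.comp (a p) (b p)) V) =
      𝔾.lieComp (Ω.mor (tan a V)) (Ω.mor (tan b V)) := by
  rw [← 𝔼.total.tanComp_tan ha hb hab, Ω.map_comp]
  exact tan_tan_comm 𝔼.total.smooth_src ha 𝔼.total.smooth_tgt hb hab V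

/-- The horizontal composition `ζ ∘_H Ψ_*`. -/
def hcomp {Ω Ω' : EquivariantForm 𝔼} {F F' : Gauge 𝔼} (ζ : Hom Ω Ω') (Ψ : Gauge.Hom F F') :
    Hom (Ω.precomp F.val) (Ω'.precomp F'.val) where
  app V := 𝔾.lieComp (ζ.app (tan F'.val.ob V)) (Ω.mor (tan Ψ.app V))
  isOneForm := by
    -- Through `lieComp_eq` the composite becomes a sum of 1-forms and their images under linear
    -- maps.
    have h : (fun V => 𝔾.lieComp (ζ.app (tan F'.val.ob V)) (Ω.mor (tan Ψ.app V))) =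
        fun V => (ζ.app (tan F'.val.ob V) + Ω.mor (tan Ψ.app V)) +
          -𝔾.lieUnit (𝔾.lieTgt (Ω.mor (tan Ψ.app V))) := funext fun V => by
      rw [lieComp_eq 𝔾 (by rw [ζ.src_app, Ω.tgt_mor_app]), sub_eq_add_neg]
    rw [h]
    have h1 := Ω.isOneForm_mor.comp_tan Ψ.smooth
    exact ((ζ.isOneForm.comp_tan F'.val.smooth_ob).add h1).add
      ((h1.map 𝔾.lieTgt).map 𝔾.lieUnit).neg
  src_app V := by
    rw [lieSrc_lieComp 𝔾 (by rw [ζ.src_app, Ω.tgt_mor_app]), Ω.src_mor_app]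
    rfl
  tgt_app V := by
    rw [lieTgt_lieComp 𝔾 (by rw [ζ.src_app, Ω.tgt_mor_app]), ζ.tgt_app]
    rfl
  natural X := by
    -- Applying `Ω` to the differential of the naturality square of `Ψ` gives `h3`. Pasting it with
    -- the naturality square of `ζ` at the image of `X` under the differential of `F'` proves the
    -- claim.
    have h1 := Ω.mor_tan_comp (Ψ.smooth.comp 𝔼.total.smooth_tgt) F.val.smooth_mor
      (fun γ => by simp [Ψ.src_app, F.val.map_tgt]) X
    have h2 := Ω.mor_tan_comp F'.val.smooth_mor (Ψ.smooth.comp 𝔼.total.smooth_src)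
      (fun γ => by simp [Ψ.tgt_app, F'.val.map_src]) X
    have h3 := (h1.symm.trans (congrArg (fun f => Ω.mor (tan f X)) (funext Ψ.natural))).trans h2
    rw [← tan_tan Ψ.smooth 𝔼.total.smooth_tgt, ← tan_tan Ψ.smooth 𝔼.total.smooth_src] at h3
    change 𝔾.lieComp (𝔾.lieComp _ _) (Ω.mor (tan F.val.mor X)) =
      𝔾.lieComp (Ω'.mor (tan F'.val.mor X)) (𝔾.lieComp _ _)
    have h4 := ζ.natural (tan F'.val.mor X)
    rw [F'.val.tan_src, F'.val.tan_tgt] at h4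
    rw [lieComp_assoc, h3, ← lieComp_assoc, h4, lieComp_assoc]
    all_goals simp only [ζ.src_app, ζ.tgt_app, Ω.src_mor_app, Ω.tgt_mor_app, Ω.map_src, Ω.map_tgt,
      Ω'.map_src, F.val.tan_tgt, F'.val.tan_src, F'.val.tan_tgt]
  equivariant V g := by
    have h : 𝔾.lieSrc (ζ.app (tan F'.val.ob V)) = 𝔾.lieTgt (Ω.mor (tan Ψ.app V)) := by
      rw [ζ.src_app, Ω.tgt_mor_app]
    have h1 : tan Ψ.app (tan (fun p => 𝔼.act.ob p g) V) =
        tan (fun γ => 𝔼.act.mor γ (𝔾.unit g)) (tan Ψ.app V) :=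
      tan_tan_comm Ψ.smooth (𝔼.act.smooth_ob_left g) (𝔼.act.smooth_mor_left _) Ψ.smooth
        (fun p => Ψ.equivariant p g) V
    -- The adjoint action of a unit arrow respects composition, since it is linear and compatible
    -- with source, target and units.
    rw [h1, F'.val.tan_act_ob, ζ.equivariant, Ω.equivariant_mor, ← unit_inv, lieComp_eq 𝔾 h,
      lieComp_eq 𝔾 (by rw [lieSrc_lieAd, lieTgt_lieAd, h, 𝔾.src_unit, 𝔾.tgt_unit]),
      lieTgt_lieAd, lieUnit_lieAd, map_sub, map_add, 𝔾.tgt_unit]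

theorem mor_tan_hinv_id (Ω : EquivariantForm 𝔼) (F : Gauge 𝔼) (V : 𝔼.total.Ob.Tan) :
    Ω.mor (tan (Gauge.hinv (𝟙 F)).app V) = 𝔾.lieUnit (Ω.ob (tan F⁻¹.val.ob V)) := by
  rw [← Ω.map_unit, tan_tan 𝔼.total.smooth_unit F⁻¹.val.smooth_ob]
  exact congrArg (fun f => Ω.mor (tan f V)) (funext (Gauge.hinv_id_app F))

theorem mor_tan_hinv_comp (Ω : EquivariantForm 𝔼) {F F' F'' : Gauge 𝔼} (Φ : F ⟶ F')
    (Ψ : F' ⟶ F'') (V : 𝔼.total.Ob.Tan) :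
    Ω.mor (tan (Gauge.hinv (Φ ≫ Ψ)).app V) =
      𝔾.lieComp (Ω.mor (tan (Gauge.hinv Ψ).app V)) (Ω.mor (tan (Gauge.hinv Φ).app V)) := by
  rw [← Ω.mor_tan_comp (Gauge.hinv Ψ).smooth (Gauge.hinv Φ).smooth
    (fun p => by rw [Gauge.Hom.src_app, Gauge.Hom.tgt_app])]
  exact congrArg (fun f => Ω.mor (tan f V)) (funext (Gauge.hinv_comp_app Φ Ψ))

theorem mor_tan_hinv_hcomp (Ω : EquivariantForm 𝔼) {F F' K K' : Gauge 𝔼} (Φ : F ⟶ F')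
    (Ψ : K ⟶ K') (V : 𝔼.total.Ob.Tan) :
    Ω.mor (tan (Gauge.hinv (Gauge.hcomp Φ Ψ)).app V) =
      𝔾.lieComp (Ω.mor (tan (Gauge.hinv Ψ).app (tan F'⁻¹.val.ob V)))
        (Ω.mor (tan K⁻¹.val.mor (tan (Gauge.hinv Φ).app V))) := by
  rw [tan_tan (Gauge.hinv Ψ).smooth F'⁻¹.val.smooth_ob,
    tan_tan K⁻¹.val.smooth_mor (Gauge.hinv Φ).smooth,
    ← Ω.mor_tan_comp ((Gauge.hinv Ψ).smooth.comp F'⁻¹.val.smooth_ob)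
      (K⁻¹.val.smooth_mor.comp (Gauge.hinv Φ).smooth) (fun p => by
        simp only [Function.comp_apply]
        rw [Gauge.Hom.src_app, K⁻¹.val.map_tgt, Gauge.Hom.tgt_app])]
  exact congrArg (fun f => Ω.mor (tan f V)) (funext (Gauge.hinv_hcomp_app Φ Ψ))

end EquivariantForm

/-! ### Stability of strict and semi-strict connections under pullback. -/

theorem IsStrict.precomp {Ω : EquivariantForm 𝔼} (h : IsStrict 𝔼 Ω) (K : BundleEnd 𝔼) :
    IsStrict 𝔼 (Ω.precomp K) :=
  ⟨fun p B => (congrArg Ω.ob (K.tan_fundOb p B)).trans (h.1 _ B),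
    fun γ A => (congrArg Ω.mor (K.tan_fundMor γ A)).trans (h.2 _ A)⟩

/-- Since the differential of `K` takes the fundamental vector of `B` at `p` to the one at `K.ob p`,
each condition at `p` is the original condition at `K.ob p`. -/
theorem EquivariantForm.VerticalIso.precomp {Ω : EquivariantForm 𝔼}
    {κ : 𝔼.total.Ob → LieAlg 𝔾.Ob → LieAlg 𝔾.Mor} (h : Ω.VerticalIso κ) (K : BundleEnd 𝔼) :
    (Ω.precomp K).VerticalIso (fun p => κ (K.ob p)) where
  smooth := h.smooth.comp ((K.smooth_ob.comp contMDiff_fst).prodMk contMDiff_snd)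
  linear p := h.linear _
  src_app p B := (h.src_app _ B).trans (congrArg Ω.ob (K.tan_fundOb p B)).symm
  tgt_app p B := h.tgt_app _ B
  natural γ A := by
    change 𝔾.lieComp _ (Ω.mor (tan K.mor (𝔼.fundMor γ A))) = _
    rw [K.tan_fundMor, ← K.map_src, ← K.map_tgt, h.natural]
  equivariant p B g := by rw [K.equivariant_ob, h.equivariant]

theorem IsSemiStrict.precomp {Ω : EquivariantForm 𝔼} (h : IsSemiStrict 𝔼 Ω) (K : BundleEnd 𝔼) :
    IsSemiStrict 𝔼 (Ω.precomp K) :=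
  let ⟨_, hκ⟩ := h
  ⟨_, hκ.precomp K⟩

/-! ### The 2-group action on a stable full subcategory. -/

variable {P : ObjectProperty (EquivariantForm 𝔼)}

/-- The action laws on arrows relate morphisms whose endpoints are only propositionally equal. The
type of the underlying 1-form does not depend on the endpoints, so comparing these forms suffices.
-/
theorem fullSubcategory_hom_heq {A B A' B' : P.FullSubcategory} (hA : A = A') (hB : B = B')
    (f : A ⟶ B) (f' : A' ⟶ B')
    (h : EquivariantForm.Hom.app f.hom = EquivariantForm.Hom.app f'.hom) : HEq f f' := by
  subst hA hB
  exact heq_of_eq (ObjectProperty.hom_ext _ (EquivariantForm.Hom.ext h))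

/-- The action of the gauge 2-group on a full subcategory of equivariant 1-forms. -/
def gaugeActionFunctor (hP : ∀ (K : BundleEnd 𝔼) (Ω : EquivariantForm 𝔼), P Ω → P (Ω.precomp K)) :
    Gauge 𝔼 × P.FullSubcategory ⥤ P.FullSubcategory where
  obj x := ⟨x.2.obj.precomp x.1⁻¹.val, hP _ _ x.2.property⟩
  map f := ObjectProperty.homMk (EquivariantForm.hcomp f.2.hom (Gauge.hinv f.1))
  map_id x := by
    refine ObjectProperty.hom_ext _ (EquivariantForm.Hom.ext (funext fun V => ?_))
    obtain ⟨F, Ω⟩ := x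
    change 𝔾.lieComp (𝔾.lieUnit (Ω.obj.ob (tan F⁻¹.val.ob V)))
      (Ω.obj.mor (tan (Gauge.hinv (𝟙 F)).app V)) = 𝔾.lieUnit (Ω.obj.ob (tan F⁻¹.val.ob V))
    rw [Ω.obj.mor_tan_hinv_id, lieUnit_lieComp_lieUnit]
  map_comp {x y z} f g := by
    refine ObjectProperty.hom_ext _ (EquivariantForm.Hom.ext (funext fun V => ?_))
    obtain ⟨Φ, ζ⟩ := f
    obtain ⟨Ψ, η⟩ := g
    -- The interchange law: naturality of `ζ` along the differential of `hinv Ψ` swaps the two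
    -- middle factors.
    have hn := EquivariantForm.Hom.natural ζ.hom (tan (Gauge.hinv Ψ).app V)
    rw [(Gauge.hinv Ψ).tan_tgt_app, (Gauge.hinv Ψ).tan_src_app] at hn
    change 𝔾.lieComp (𝔾.lieComp (EquivariantForm.Hom.app η.hom (tan z.1⁻¹.val.ob V))
        (EquivariantForm.Hom.app ζ.hom (tan z.1⁻¹.val.ob V)))
        (x.2.obj.mor (tan (Gauge.hinv (Φ ≫ Ψ)).app V)) =
      𝔾.lieComp (𝔾.lieComp (EquivariantForm.Hom.app η.hom (tan z.1⁻¹.val.ob V))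
        (y.2.obj.mor (tan (Gauge.hinv Ψ).app V)))
        (𝔾.lieComp (EquivariantForm.Hom.app ζ.hom (tan y.1⁻¹.val.ob V))
          (x.2.obj.mor (tan (Gauge.hinv Φ).app V)))
    rw [x.2.obj.mor_tan_hinv_comp, lieComp_assoc, ← lieComp_assoc 𝔾
      (A₃ := EquivariantForm.Hom.app ζ.hom _), hn, lieComp_assoc, lieComp_assoc]
    all_goals first
      | rw [lieTgt_lieComp]
      | skip
    all_goals simp only [EquivariantForm.Hom.src_app, EquivariantForm.Hom.tgt_app,
      EquivariantForm.src_mor_app, EquivariantForm.tgt_mor_app]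

/-- The gauge 2-group acts on every full subcategory of equivariant 1-forms that is stable under
precomposition with the differentials of bundle endomorphisms. -/
def gaugeAction (hP : ∀ (K : BundleEnd 𝔼) (Ω : EquivariantForm 𝔼), P Ω → P (Ω.precomp K)) :
    Strict2GroupAction (Gauge 𝔼) P.FullSubcategory where
  functor := gaugeActionFunctor hP
  one_obj c := ObjectProperty.FullSubcategory.ext c.obj.precomp_one
  mul_obj a b c := ObjectProperty.FullSubcategory.ext
    -- The inverse of `a * b` is definitionally `b⁻¹ * a⁻¹`, and precomposition reverses the order
    -- again.
    (c.obj.precomp_mul b⁻¹.val a⁻¹.val)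
  one_map {c c'} f := by
    refine fullSubcategory_hom_heq (ObjectProperty.FullSubcategory.ext c.obj.precomp_one)
      (ObjectProperty.FullSubcategory.ext c'.obj.precomp_one) _ _ (funext fun V => ?_)
    change 𝔾.lieComp (EquivariantForm.Hom.app f.hom (tan id V))
      (c.obj.mor (tan (Gauge.hinv (𝟙 (1 : Gauge 𝔼))).app V)) = EquivariantForm.Hom.app f.hom V
    have h : tan (1 : Gauge 𝔼)⁻¹.val.ob V = V := tan_id V
    rw [c.obj.mor_tan_hinv_id, h, tan_id, ← EquivariantForm.Hom.src_app f.hom, lieComp_lieUnit]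
  mul_map {a a' b b' c c'} φ ψ f := by
    refine fullSubcategory_hom_heq
      (ObjectProperty.FullSubcategory.ext (c.obj.precomp_mul b⁻¹.val a⁻¹.val))
      (ObjectProperty.FullSubcategory.ext (c'.obj.precomp_mul b'⁻¹.val a'⁻¹.val)) _ _
      (funext fun V => ?_)
    change 𝔾.lieComp (EquivariantForm.Hom.app f.hom (tan (b'⁻¹.val.ob ∘ a'⁻¹.val.ob) V))
        (c.obj.mor (tan (Gauge.hinv (Gauge.hcomp φ ψ)).app V)) =
      𝔾.lieComp (𝔾.lieComp (EquivariantForm.Hom.app f.hom (tan b'⁻¹.val.ob (tan a'⁻¹.val.ob V)))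
        (c.obj.mor (tan (Gauge.hinv ψ).app (tan a'⁻¹.val.ob V))))
        (c.obj.mor (tan b⁻¹.val.mor (tan (Gauge.hinv φ).app V)))
    -- Once the inverse of the horizontal composite is expanded, both sides are the same triple
    -- composite in `L(𝔾)`, bracketed differently.
    rw [c.obj.mor_tan_hinv_hcomp, ← tan_tan b'⁻¹.val.smooth_ob a'⁻¹.val.smooth_ob, lieComp_assoc]
    · rw [EquivariantForm.Hom.src_app, EquivariantForm.tgt_mor_app]
    · rw [EquivariantForm.src_mor_app, EquivariantForm.map_tgt, b⁻¹.val.tan_tgt,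
        Gauge.Hom.tan_tgt_app]

end GaugeAction

end

/-- The gauge 2-group of a principal 2-bundle acts on the category of semi-strict connection
1-forms, by `(F, Ω) ↦ Ω ∘ F_*⁻¹` on objects and by the horizontal composition
`(Ψ, ζ) ↦ ζ ∘_H Ψ_*⁻¹` on morphisms, and the action restricts to strict connection 1-forms. -/
theorem mainTheorem9 (𝔾 : Lie2Group.{w}) (𝕏 : LieGroupoid.{v}) (𝔼 : Principal2Bundle.{u} 𝔾 𝕏) :
    ∃ A : Strict2GroupAction (Gauge 𝔼) (SemiStrictConnections 𝔼),
      (∀ (F : Gauge 𝔼) (Ω : SemiStrictConnections 𝔼),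
        (∀ V : 𝔼.total.Ob.Tan,
          (A.functor.obj (F, Ω)).obj.ob V = Ω.obj.ob (tan F⁻¹.val.ob V)) ∧
        (∀ X : 𝔼.total.Mor.Tan,
          (A.functor.obj (F, Ω)).obj.mor X = Ω.obj.mor (tan F⁻¹.val.mor X))) ∧
      (∀ (F F' : Gauge 𝔼) (Ω Ω' : SemiStrictConnections 𝔼) (Ψ : F ⟶ F') (ζ : Ω ⟶ Ω')
        (V : 𝔼.total.Ob.Tan),
        EquivariantForm.Hom.app (A.functor.map (Prod.mkHom Ψ ζ)).hom V =
          𝔾.lieComp (EquivariantForm.Hom.app ζ.hom (tan F'⁻¹.val.ob V))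
            (Ω.obj.mor (tan (Gauge.Hom.app (Strict2Group.hinv Ψ)) V))) ∧
      ∃ A' : Strict2GroupAction (Gauge 𝔼) (StrictConnections 𝔼),
        A'.functor ⋙ strictInclusion 𝔼 =
          (𝟭 (Gauge 𝔼)).prod (strictInclusion 𝔼) ⋙ A.functor := by
  -- Both actions are instances of one construction, so the prescribed formulas and the
  -- compatibility with the inclusion hold definitionally.
  refine ⟨gaugeAction fun K _ h => IsSemiStrict.precomp h K,
    fun _ _ => ⟨fun _ => rfl, fun _ => rfl⟩, fun _ _ _ _ _ _ _ => rfl,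
    gaugeAction fun K _ h => IsStrict.precomp h K, rfl⟩
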